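/- Let $M$ be a closed (compact, without boundary) smooth manifold of dimension $n$, let $\mathcal F$ be a smooth foliation of $M$ of dimension $p$ with leafwise tangent bundle $T\mathcal F\subset TM$, and let $g$ be a bundle-like Riemannian metric on $M$ (i.e. in every foliated chart the coefficients of the metric induced by $g$ on the normal bundle $T\mathcal F^{\perp}$ depend on the transverse coordinates only). Assume that $T\mathcal F$ is oriented, with leafwise volume form $\chi_{\mathcal F}$. Let $\Omega^{0,k}(M,\mathcal F)$ be the space of smooth leafwise $k$-forms, that is, of smooth sections of $\Lambda^kT^*\mathcal F$, identified by means of $g$ with the $k$-forms on $M$ that vanish if one argument lies in $T\mathcal F^\perp$. Let $d_{\mathcal F}:\Omega^{0,k}(M,\mathcal F)\to\Omega^{0,k+1}(M,\mathcal F)$ be the leafwise exterior derivative (the $T\mathcal F$-component of $d$), and let $*_{\mathcal F}:\Omega^{0,k}(M,\mathcal F)\to\Omega^{0,p-k}(M,\mathcal F)$, $0\le k\le p$, be the leafwise Hodge star operator, determined fibrewise by $\alpha\wedge *_{\mathcal F}\beta=\langle\alpha,\beta\rangle\,\chi_{\mathcal F}$. For a leafwise $1$-form $\omega\in\Omega^{0,1}(M,\mathcal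 F)$ with $d_{\mathcal F}\omega=0$ put $d^{\omega}_{\mathcal F}=d_{\mathcal F}+\omega\wedge$, let $\delta^{\omega}_{\mathcal F}$ be its formal adjoint with respect to the inner product $(\alpha,\beta)=\int_M\langle\alpha,\beta\rangle\,\mathrm{vol}_g$ on smooth leafwise forms, and let $\Delta_{\mathcal F,\omega}=d^{\omega}_{\mathcal F}\delta^{\omega}_{\mathcal F}+\delta^{\omega}_{\mathcal F}d^{\omega}_{\mathcal F}$ (with $\delta^\omega_{\mathcal F}=0$ on functions). Then these operators are well defined: $d^{\omega}_{\mathcal F}$ and $*_{\mathcal F}$ map smooth leafwise forms to smooth leafwise forms, the relation determining $*_{\mathcal F}\beta$ has exactly one solution at every point, and for every $\beta\in\Omega^{0,k+1}(M,\mathcal F)$ there is exactly one $\delta^\omega_{\mathcal F}\beta\in\Omega^{0,k}(M,\mathcal F)$ with $(d^\omega_{\mathcal F}\alpha,\beta)=(\alpha,\delta^\omega_{\mathcal F}\beta)$ for all $\alpha\in\Omega^{0,k}(M,\mathcal F)$. Moreover $$*_{\mathcal F}\,\Delta_{\mathcal F,\omega}\,\beta=\Delta_{\mathcal F,-\omega}\,*_{\mathcal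 F}\,\beta\qquad\text{for all }\beta\in\Omega^{0,k}(M,\mathcal F),\ 0\le k\le p,$$ and consequently $*_{\mathcal F}$ maps $\Delta_{\mathcal F,\omega}$-harmonic forms to $\Delta_{\mathcal F,-\omega}$-harmonic forms. -/

import Mathlib

open Bundle Manifold MeasureTheory
open scoped ContDiff

noncomputable section

namespace Leafwise

/-- The model `ℝⁿ`. -/
abbrev Model (n : ℕ) : Type := EuclideanSpace ℝ (Fin n)

/-- The subspace `ℝᵖ × {0}` of `ℝⁿ`. -/
def leafModel (n p : ℕ) : Submodule ℝ (Model n) where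
  carrier := {v | ∀ i : Fin n, p ≤ (i : ℕ) → v i = 0}
  add_mem' := by
    intro a b ha hb i hi
    simp [ha i hi, hb i hi]
  zero_mem' := by
    intro i _
    simp
  smul_mem' := by
    intro c a ha i hi
    simp [ha i hi]

section Foliation

variable {n : ℕ} {M : Type*} [TopologicalSpace M] [ChartedSpace (Model n) M]

/-- `φ` is a smooth chart of `M` in which the distribution `D` is everywhere spanned by the first
`p` coordinate vector fields. -/
def IsFlatChart (p : ℕ) (D : ∀ x : M, Submodule ℝ (TangentSpace (𝓡 n) x))
    (φ : OpenPartialHomeomorph M (Model n)) : Prop :=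
  φ ∈ IsManifold.maximalAtlas (𝓡 n) ∞ M ∧
    ∀ y ∈ φ.source, ∀ v : TangentSpace (𝓡 n) y,
      v ∈ D y ↔ (mfderiv (𝓡 n) (𝓡 n) φ y v : Model n) ∈ leafModel n p

variable (n M) in
/-- A smooth `p`-dimensional foliation of `M`, given by its leafwise tangent bundle `T𝓕`: around
every point there is a foliated chart, that is, a smooth chart whose slices
`{x_{p+1} = c_{p+1}, …, x_n = c_n}` are tangent to `T𝓕`. The leaves are obtained by gluing these
slices. -/
structure Foliation (p : ℕ) where
  /-- the tangent space at `x` of the leaf through `x` -/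
  tangent : ∀ x : M, Submodule ℝ (TangentSpace (𝓡 n) x)
  finrank_tangent : ∀ x, Module.finrank ℝ (tangent x) = p
  exists_flatChart : ∀ x, ∃ φ : OpenPartialHomeomorph M (Model n),
    x ∈ φ.source ∧ IsFlatChart p tangent φ

end Foliation

variable {n p k l m : ℕ} {M : Type*} [TopologicalSpace M] [ChartedSpace (Model n) M]

instance finiteDimensional_tangentSpace (x : M) : FiniteDimensional ℝ (TangentSpace (𝓡 n) x) :=
  inferInstanceAs (FiniteDimensional ℝ (Model n))

instance fact_finrank_tangent (F : Foliation n M p) (x : M) : Fact (Module.finrank ℝ (F.tangent x) = p) :=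
  ⟨F.finrank_tangent x⟩

/-- Fields of alternating `k`-forms on the leafwise tangent spaces, i.e. arbitrary (not necessarily
smooth) sections of `Λᵏ T*𝓕`. -/
abbrev LeafForm (F : Foliation n M p) (k : ℕ) : Type _ :=
  ∀ x : M, (F.tangent x) [⋀^Fin k]→ₗ[ℝ] ℝ

/-- The (shuffle) wedge product of alternating forms. -/
def wedgeAlt {V : Type*} [AddCommGroup V] [Module ℝ V] (h : k + l = m)
    (a : V [⋀^Fin k]→ₗ[ℝ] ℝ) (b : V [⋀^Fin l]→ₗ[ℝ] ℝ) : V [⋀^Fin m]→ₗ[ℝ] ℝ :=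
  ((LinearMap.mul' ℝ ℝ).compAlternatingMap (a.domCoprod b)).domDomCongr
    (finSumFinEquiv.trans (finCongr h))

/-- The inner product on `Λᵏ V*` induced by the one of `V`: for an orthonormal basis `e` of `V`
the forms `e^{i₁} ∧ ⋯ ∧ e^{i_k}` with `i₁ < ⋯ < i_k` are orthonormal. The sum runs over all
`k`-tuples of indices, so each increasing one is counted `k!` times. -/
def innerAlt {V : Type*} [NormedAddCommGroup V] [InnerProductSpace ℝ V] [FiniteDimensional ℝ V]
    (a b : V [⋀^Fin k]→ₗ[ℝ] ℝ) : ℝ :=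
  (k.factorial : ℝ)⁻¹ * ∑ I : Fin k → Fin (Module.finrank ℝ V),
    a (fun j => stdOrthonormalBasis ℝ V (I j)) * b (fun j => stdOrthonormalBasis ℝ V (I j))

/-- `c` is the Hodge dual of `b`: `a ∧ c = ⟨a, b⟩ vol` for every `a`. -/
def IsStarAlt {V : Type*} [NormedAddCommGroup V] [InnerProductSpace ℝ V]
    [FiniteDimensional ℝ V] [Fact (Module.finrank ℝ V = p)] (o : Orientation ℝ V (Fin p))
    (h : k + l = p) (b : V [⋀^Fin k]→ₗ[ℝ] ℝ) (c : V [⋀^Fin l]→ₗ[ℝ] ℝ) : Prop :=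
  ∀ a : V [⋀^Fin k]→ₗ[ℝ] ℝ, wedgeAlt h a c = innerAlt a b • o.volumeForm

open Classical in
/-- The Hodge star operator `Λᵏ V* → Λˡ V*`, `k + l = p = dim V`. -/
def starAlt {V : Type*} [NormedAddCommGroup V] [InnerProductSpace ℝ V]
    [FiniteDimensional ℝ V] [Fact (Module.finrank ℝ V = p)] (o : Orientation ℝ V (Fin p))
    (h : k + l = p) (b : V [⋀^Fin k]→ₗ[ℝ] ℝ) : V [⋀^Fin l]→ₗ[ℝ] ℝ :=
  if hb : ∃ c, IsStarAlt o h b c then hb.choose else 0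

theorem continuous_alt (a : Model n [⋀^Fin k]→ₗ[ℝ] ℝ) : Continuous a := by
  have h : ∀ v : Fin k → Model n, a v = ∑ r : Fin k → Fin n,
      (∏ i, v i (r i)) * a (fun i => EuclideanSpace.basisFun (Fin n) ℝ (r i)) := by
    intro v
    have hv : v = fun i => ∑ j, v i j • EuclideanSpace.basisFun (Fin n) ℝ j := by
      funext i
      simpa using ((EuclideanSpace.basisFun (Fin n) ℝ).sum_repr (v i)).symm
    conv_lhs => rw [hv]
    have h1 := a.toMultilinearMap.map_sum
      (g := fun (i : Fin k) (j : Fin n) => v i j • EuclideanSpace.basisFun (Fin n) ℝ j)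
    refine h1.trans (Finset.sum_congr rfl fun r _ => ?_)
    exact a.toMultilinearMap.map_smul_univ _ _
  rw [show (a : (Fin k → Model n) → ℝ) = _ from funext h]
  fun_prop

/-- An alternating form on `ℝⁿ` as a continuous alternating form. -/
def toContinuousAlt (a : Model n [⋀^Fin k]→ₗ[ℝ] ℝ) : Model n [⋀^Fin k]→L[ℝ] ℝ :=
  { a with cont := continuous_alt a }

/-- The derivative at `u` of the inverse of the chart `φ`. -/
def chartInvDeriv (φ : OpenPartialHomeomorph M (Model n)) (u : Model n) :
    Model n →L[ℝ] TangentSpace (𝓡 n) (φ.symm u) :=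
  mfderiv (𝓡 n) (𝓡 n) φ.symm u

/-- The derivative at `x` of the chart `φ`. -/
def chartDeriv (φ : OpenPartialHomeomorph M (Model n)) (x : M) :
    TangentSpace (𝓡 n) x →L[ℝ] Model n :=
  mfderiv (𝓡 n) (𝓡 n) φ x

section Riemannian

variable [RiemannianBundle (fun x : M => TangentSpace (𝓡 n) x)]

/-- The volume density `√(det g_{ij})` of the Riemannian metric in the chart `φ`. -/
def volDensity (φ : OpenPartialHomeomorph M (Model n)) (u : Model n) : ℝ :=
  √(Matrix.det (Matrix.of fun i j : Fin n =>
    (inner ℝ (chartInvDeriv φ u (EuclideanSpace.basisFun (Fin n) ℝ i))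
      (chartInvDeriv φ u (EuclideanSpace.basisFun (Fin n) ℝ j)) : ℝ)))

/-- The Riemannian volume of the domain of the chart `φ`, extended by zero to `M`. -/
def chartVolume [MeasurableSpace M] (φ : OpenPartialHomeomorph M (Model n)) : Measure M :=
  (((volume : Measure (Model n)).restrict φ.target).withDensity
    fun u => ENNReal.ofReal (volDensity φ u)).map φ.symm

variable (n M) in
/-- The Riemannian volume measure: the smallest measure on `M` which dominates the chart volume
`√(det g_{ij}) dx` of every chart of the atlas. Since these agree on the overlaps of the charts,
it restricts to each of them on the domain of the corresponding chart. -/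
def riemannianVolume [MeasurableSpace M] : Measure M :=
  ⨆ φ ∈ atlas (Model n) M, chartVolume φ

variable {F : Foliation n M p}

/-- The leafwise form `α`, extended by zero on the normal bundle `T𝓕^⊥`, in the chart `φ`. -/
def chartForm (α : LeafForm F k) (φ : OpenPartialHomeomorph M (Model n)) (u : Model n) :
    Model n [⋀^Fin k]→L[ℝ] ℝ :=
  toContinuousAlt ((α (φ.symm u)).compLinearMap
    ((F.tangent (φ.symm u)).orthogonalProjectionOnto.toLinearMap ∘ₗ (chartInvDeriv φ u).toLinearMap))

/-- `α ∈ Ω^{0,k}(M, 𝓕)`: the form `α` is smooth in the charts of the atlas. -/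
def IsSmooth (α : LeafForm F k) : Prop :=
  ∀ φ ∈ atlas (Model n) M, ContDiffOn ℝ ∞ (chartForm α φ) φ.target

/-- The leafwise differential `d_𝓕 = d_{0,1}`: the restriction to `T𝓕` of the exterior derivative
of the form on `M` which extends `α` by zero on `T𝓕^⊥`. -/
def leafD (α : LeafForm F k) : LeafForm F (k + 1) := fun x =>
  (extDeriv (chartForm α (chartAt (Model n) x))
    (chartAt (Model n) x x)).toAlternatingMap.compLinearMap
      ((chartDeriv (chartAt (Model n) x) x).toLinearMap ∘ₗ (F.tangent x).subtype)

/-- The wedge product of leafwise forms. -/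
def wedge (h : k + l = m) (α : LeafForm F k) (β : LeafForm F l) : LeafForm F m :=
  fun x => wedgeAlt h (α x) (β x)

/-- The twisted differential `d_𝓕 + η ∧`. -/
def twistedD (η : LeafForm F 1) (α : LeafForm F k) : LeafForm F (k + 1) :=
  leafD α + wedge (Nat.add_comm 1 k) η α

/-- The inner product `(α, β) = ∫_M ⟨α, β⟩_𝓕 vol`. -/
def l2Inner [MeasurableSpace M] (α β : LeafForm F k) : ℝ :=
  ∫ x, innerAlt (α x) (β x) ∂(riemannianVolume n M)

/-- The smooth leafwise form `γ` is the value at `β` of the formal adjoint of `d_𝓕 + η ∧`. -/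
def IsAdjointValue [MeasurableSpace M] (η : LeafForm F 1) (β : LeafForm F (k + 1))
    (γ : LeafForm F k) : Prop :=
  IsSmooth γ ∧ ∀ α : LeafForm F k, IsSmooth α → l2Inner (twistedD η α) β = l2Inner α γ

open Classical in
/-- The formal adjoint of `d_𝓕 + η ∧`. -/
def twistedDelta [MeasurableSpace M] (η : LeafForm F 1) (β : LeafForm F (k + 1)) : LeafForm F k :=
  if h : ∃ γ, IsAdjointValue η β γ then h.choose else 0

/-- The twisted leafwise Laplacian `Δ_{𝓕,η}`, the Laplacian of the differential `d_𝓕 + η ∧`. -/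
def twistedLaplacian [MeasurableSpace M] (η : LeafForm F 1) :
    ∀ {k : ℕ}, LeafForm F k → LeafForm F k
  | 0, α => twistedDelta η (twistedD η α)
  | _ + 1, α => twistedD η (twistedDelta η α) + twistedDelta η (twistedD η α)

/-- The smooth leafwise form `α` is `Δ_{𝓕,η}`-harmonic. -/
def IsHarmonic [MeasurableSpace M] (η : LeafForm F 1) (α : LeafForm F k) : Prop :=
  IsSmooth α ∧ twistedLaplacian η α = 0

/-- An orientation of the bundle `T𝓕`: the orientations of the fibres are represented by a nowhere
vanishing smooth leafwise `p`-form. -/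
def IsLeafOrientation (o : ∀ x : M, Orientation ℝ (F.tangent x) (Fin p)) : Prop :=
  ∃ θ : LeafForm F p, IsSmooth θ ∧ ∀ x, ∃ h : θ x ≠ 0, o x = rayOfNeZero ℝ (θ x) h

/-- The leafwise Hodge star operator. -/
def hodgeStar (o : ∀ x : M, Orientation ℝ (F.tangent x) (Fin p)) (h : k + l = p)
    (β : LeafForm F k) : LeafForm F l :=
  fun x => starAlt (o x) h (β x)

/-- The coefficients of the metric of the normal bundle `T𝓕^⊥` in the chart `φ`: the inner product
of the normal components of the constant coordinate fields `v` and `w`. -/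
def normalMetric (F : Foliation n M p) (φ : OpenPartialHomeomorph M (Model n)) (v w u : Model n) :
    ℝ :=
  inner ℝ ((F.tangent (φ.symm u))ᗮ.starProjection (chartInvDeriv φ u v))
    ((F.tangent (φ.symm u))ᗮ.starProjection (chartInvDeriv φ u w))

/-- The Riemannian metric is bundle-like: in foliated charts the coefficients of its normal part
are constant along the leaves, i.e. depend on the transverse coordinates only. -/
def IsBundleLike (F : Foliation n M p) : Prop :=
  ∀ φ : OpenPartialHomeomorph M (Model n), IsFlatChart p F.tangent φ →
    ∀ v w : Model n, ∀ u ∈ φ.target, ∀ e ∈ leafModel n p,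
      fderiv ℝ (normalMetric F φ v w) u e = 0

end Riemannian

end Leafwise

end

/-!
The integral over `M` of the leafwise divergence of a leafwise field vanishes: in a foliated chart
the Riemannian density is the leafwise density times the density of the normal metric, and for a
bundle-like metric the latter is constant along the leaves, so that the integral over the chart
reduces to the divergence theorem in the leaf directions. In terms of forms,
`(d_𝓕 ξ, χ_𝓕) = 0` for every leafwise `(p - 1)`-form `ξ`.

Apply this to `ξ = α ∧ *β`. In the Leibniz rule the terms with `ω` cancel if `α` is differentiated
with `d + ω ∧` and `*β` with `d - ω ∧`, so `(d^ω α, β)` is up to sign the integral of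
`α ∧ d^{-ω} *β`. Hence `δ^ω = ± * d^{-ω} *`. It follows that `*` exchanges `δ^ω` with `± d^{-ω}`
and `d^ω` with `± δ^{-ω}`; each of the two summands of the Laplacian involves the same sign twice.
-/

noncomputable section

namespace Leafwise

section Antisymmetrization

variable {ι V : Type*} [Fintype ι] [DecidableEq ι]

/-- The antisymmetrization `v ↦ ∑ₛ sign s · Φ (v ∘ s)` of a function of a family of vectors,
without the factor `1 / |ι|!`, so that the averages over subgroups of permutations which relate
wedge products to exterior derivatives become identities between sums over the whole group. -/
def antisymSum (Φ : (ι → V) → ℝ) (v : ι → V) : ℝ :=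
  ∑ s : Equiv.Perm ι, ((Equiv.Perm.sign s : ℤ) : ℝ) * Φ (v ∘ s)

theorem sign_mul_self (s : Equiv.Perm ι) :
    ((Equiv.Perm.sign s : ℤ) : ℝ) * ((Equiv.Perm.sign s : ℤ) : ℝ) = 1 := by
  rw [← Int.cast_mul, ← Units.val_mul, Int.units_mul_self, Units.val_one, Int.cast_one]

theorem antisymSum_add (Φ Ψ : (ι → V) → ℝ) (v : ι → V) :
    antisymSum (fun u => Φ u + Ψ u) v = antisymSum Φ v + antisymSum Ψ v := by
  simp only [antisymSum, mul_add, Finset.sum_add_distrib]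

theorem antisymSum_const_mul (c : ℝ) (Φ : (ι → V) → ℝ) (v : ι → V) :
    antisymSum (fun u => c * Φ u) v = c * antisymSum Φ v := by
  simp only [antisymSum, Finset.mul_sum, mul_left_comm]

theorem antisymSum_comp_perm (Φ : (ι → V) → ℝ) (r : Equiv.Perm ι) (v : ι → V) :
    antisymSum (fun u => Φ (u ∘ r)) v = ((Equiv.Perm.sign r : ℤ) : ℝ) * antisymSum Φ v := by
  rw [antisymSum, antisymSum, Finset.mul_sum]
  refine Fintype.sum_equiv (Equiv.mulRight r) _ _ fun s => ?_
  have hsign : ((Equiv.Perm.sign (s * r) : ℤ) : ℝ) =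
      ((Equiv.Perm.sign s : ℤ) : ℝ) * ((Equiv.Perm.sign r : ℤ) : ℝ) := by
    rw [Equiv.Perm.sign_mul, Units.val_mul, Int.cast_mul]
  calc ((Equiv.Perm.sign s : ℤ) : ℝ) * Φ ((v ∘ s) ∘ r)
      = ((Equiv.Perm.sign s : ℤ) : ℝ) *
          (((Equiv.Perm.sign r : ℤ) : ℝ) * ((Equiv.Perm.sign r : ℤ) : ℝ)) * Φ (v ∘ (s * r)) := by
        rw [sign_mul_self, mul_one, Equiv.Perm.coe_mul, Function.comp_assoc]
    _ = ((Equiv.Perm.sign r : ℤ) : ℝ) *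
          (((Equiv.Perm.sign (s * r) : ℤ) : ℝ) * Φ (v ∘ (s * r))) := by
        rw [hsign]
        ring

theorem antisymSum_sum_sign_mul {J : Type*} [Fintype J] (Φ : (ι → V) → ℝ) (r : J → Equiv.Perm ι)
    (v : ι → V) :
    antisymSum (fun u => ∑ j, ((Equiv.Perm.sign (r j) : ℤ) : ℝ) * Φ (u ∘ r j)) v =
      Fintype.card J * antisymSum Φ v := by
  calc antisymSum (fun u => ∑ j, ((Equiv.Perm.sign (r j) : ℤ) : ℝ) * Φ (u ∘ r j)) v
      = ∑ j, ((Equiv.Perm.sign (r j) : ℤ) : ℝ) * antisymSum (fun u => Φ (u ∘ r j)) v := by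
        simp only [antisymSum, Finset.mul_sum]
        rw [Finset.sum_comm]
        exact Finset.sum_congr rfl fun j _ => Finset.sum_congr rfl fun s _ => mul_left_comm _ _ _
    _ = ∑ _j : J, antisymSum Φ v := by
        simp only [antisymSum_comp_perm, ← mul_assoc, sign_mul_self, one_mul]
    _ = Fintype.card J * antisymSum Φ v := by
        rw [Finset.sum_const, Finset.card_univ, nsmul_eq_mul]

variable [AddCommGroup V] [Module ℝ V]

theorem alternatingMap_comp_perm (a : V [⋀^ι]→ₗ[ℝ] ℝ) (v : ι → V) (s : Equiv.Perm ι) :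
    a (v ∘ s) = ((Equiv.Perm.sign s : ℤ) : ℝ) * a v := by
  rw [a.map_perm, Units.smul_def, zsmul_eq_mul]

theorem antisymSum_alternatingMap (a : V [⋀^ι]→ₗ[ℝ] ℝ) (v : ι → V) :
    antisymSum a v = (Fintype.card ι).factorial * a v := by
  simp only [antisymSum, alternatingMap_comp_perm, ← mul_assoc, sign_mul_self, one_mul,
    Finset.sum_const, Finset.card_univ, Fintype.card_perm, nsmul_eq_mul]

end Antisymmetrization

section AlternatizeUncurry

variable {k m : ℕ} {V : Type*}

theorem antisymSum_antisymSum_tail (Ψ : V → (Fin m → V) → ℝ) (v : Fin (m + 1) → V) :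
    antisymSum (fun u => antisymSum (Ψ (u 0)) (Fin.tail u)) v =
      m.factorial * antisymSum (fun u => Ψ (u 0) (Fin.tail u)) v := by
  have h := antisymSum_sum_sign_mul (fun u : Fin (m + 1) → V => Ψ (u 0) (Fin.tail u))
    (fun s : Equiv.Perm (Fin m) => Equiv.Perm.decomposeFin.symm (0, s)) v
  rw [Fintype.card_perm, Fintype.card_fin] at h
  rw [← h]
  congr 1
  funext u
  refine Finset.sum_congr rfl fun s _ => ?_
  have htail : Fin.tail (u ∘ Equiv.Perm.decomposeFin.symm (0, s)) = Fin.tail u ∘ s := by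
    funext j
    simp [Fin.tail, Equiv.Perm.decomposeFin_symm_apply_succ]
  rw [htail, Equiv.Perm.decomposeFin.symm_sign]
  simp

variable [AddCommGroup V] [Module ℝ V]

theorem alternatizeUncurryFin_eq_sum_sign (A : V →ₗ[ℝ] V [⋀^Fin k]→ₗ[ℝ] ℝ) (v : Fin (k + 1) → V) :
    AlternatingMap.alternatizeUncurryFin A v =
      ∑ i : Fin (k + 1), ((Equiv.Perm.sign i.cycleRange.symm : ℤ) : ℝ) *
        A ((v ∘ i.cycleRange.symm) 0) (Fin.tail (v ∘ i.cycleRange.symm)) := by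
  rw [AlternatingMap.alternatizeUncurryFin_apply]
  refine Finset.sum_congr rfl fun i _ => ?_
  have htail : Fin.tail (v ∘ i.cycleRange.symm) = i.removeNth v := by
    funext j
    simp [Fin.tail, Fin.removeNth]
  rw [htail, Equiv.Perm.sign_symm, Fin.sign_cycleRange, Function.comp_apply,
    Fin.cycleRange_symm_zero, zsmul_eq_mul, Units.val_pow_eq_pow_val, Units.val_neg, Units.val_one]

theorem factorial_mul_alternatizeUncurryFin (A : V →ₗ[ℝ] V [⋀^Fin k]→ₗ[ℝ] ℝ)
    (v : Fin (k + 1) → V) :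
    (k.factorial : ℝ) * AlternatingMap.alternatizeUncurryFin A v =
      antisymSum (fun u => A (u 0) (Fin.tail u)) v := by
  have hk : (k + 1 : ℝ) ≠ 0 := by positivity
  apply mul_left_cancel₀ hk
  have h := antisymSum_sum_sign_mul (fun u : Fin (k + 1) → V => A (u 0) (Fin.tail u))
    (fun i : Fin (k + 1) => i.cycleRange.symm) v
  simp only [← alternatizeUncurryFin_eq_sum_sign] at h
  rw [antisymSum_alternatingMap, Fintype.card_fin, Nat.factorial_succ] at h
  push_cast at h
  rw [← mul_assoc, h]

end AlternatizeUncurry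

section Wedge

variable {k l m : ℕ} {V : Type*}

/-- The identification of the indices `0, …, m - 1` with a first block of `k` and a second block
of `l = m - k` indices which underlies `wedgeAlt`. -/
def blockEquiv (h : k + l = m) : Fin k ⊕ Fin l ≃ Fin m :=
  finSumFinEquiv.trans (finCongr h)

theorem blockEquiv_inl_val (h : k + l = m) (i : Fin k) : (blockEquiv h (.inl i) : ℕ) = i := rfl

theorem blockEquiv_inr_val (h : k + l = m) (j : Fin l) : (blockEquiv h (.inr j) : ℕ) = k + j := rfl

/-- The permutation of `k + l = m` indices which permutes the two blocks separately. -/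
def blockPerm (h : k + l = m) (s : Equiv.Perm (Fin k)) (t : Equiv.Perm (Fin l)) :
    Equiv.Perm (Fin m) :=
  (blockEquiv h).permCongr (s.sumCongr t)

theorem sign_blockPerm (h : k + l = m) (s : Equiv.Perm (Fin k)) (t : Equiv.Perm (Fin l)) :
    Equiv.Perm.sign (blockPerm h s t) = Equiv.Perm.sign s * Equiv.Perm.sign t := by
  rw [blockPerm, Equiv.Perm.sign_permCongr, Equiv.Perm.sign_sumCongr]

theorem blockPerm_inl (h : k + l = m) (s : Equiv.Perm (Fin k)) (t : Equiv.Perm (Fin l))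
    (i : Fin k) : blockPerm h s t (blockEquiv h (.inl i)) = blockEquiv h (.inl (s i)) := by
  simp [blockPerm, Equiv.permCongr_apply]

theorem blockPerm_inr (h : k + l = m) (s : Equiv.Perm (Fin k)) (t : Equiv.Perm (Fin l))
    (j : Fin l) : blockPerm h s t (blockEquiv h (.inr j)) = blockEquiv h (.inr (t j)) := by
  simp [blockPerm, Equiv.permCongr_apply]

variable [AddCommGroup V] [Module ℝ V]

theorem factorial_mul_wedgeAlt_apply (h : k + l = m) (a : V [⋀^Fin k]→ₗ[ℝ] ℝ)
    (b : V [⋀^Fin l]→ₗ[ℝ] ℝ) (v : Fin m → V) :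
    ((k.factorial : ℝ) * l.factorial) * wedgeAlt h a b v =
      antisymSum (fun u => a (fun i => u (blockEquiv h (.inl i))) *
        b (fun j => u (blockEquiv h (.inr j)))) v := by
  have key := congrArg (fun f : V [⋀^Fin k ⊕ Fin l]→ₗ[ℝ] (TensorProduct ℝ ℝ ℝ) =>
    LinearMap.mul' ℝ ℝ (f (v ∘ blockEquiv h))) (MultilinearMap.domCoprod_alternization_eq a b)
  simp only [MultilinearMap.alternatization_apply, map_sum, Fintype.card_fin] at key
  have hcount : ((k.factorial : ℝ) * l.factorial) * wedgeAlt h a b v = LinearMap.mul' ℝ ℝ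
      (((k.factorial * l.factorial) • a.domCoprod b) (v ∘ blockEquiv h)) := by
    rw [AlternatingMap.smul_apply, map_nsmul, nsmul_eq_mul, Nat.cast_mul]
    rfl
  rw [hcount, ← key]
  refine Fintype.sum_equiv (blockEquiv h).permCongr _ _ fun s => ?_
  rw [Equiv.Perm.sign_permCongr, Units.smul_def, map_zsmul, zsmul_eq_mul]
  simp [MultilinearMap.domDomCongr_apply, Equiv.permCongr_apply]

theorem wedgeAlt_apply (h : k + l = m) (a : V [⋀^Fin k]→ₗ[ℝ] ℝ)
    (b : V [⋀^Fin l]→ₗ[ℝ] ℝ) (v : Fin m → V) :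
    wedgeAlt h a b v = ((k.factorial : ℝ) * l.factorial)⁻¹ *
      antisymSum (fun u => a (fun i => u (blockEquiv h (.inl i))) *
        b (fun j => u (blockEquiv h (.inr j)))) v := by
  rw [← factorial_mul_wedgeAlt_apply, inv_mul_cancel_left₀ (by positivity)]

/-- The wedge product as a bilinear map. -/
def wedgeBilin (h : k + l = m) :
    V [⋀^Fin k]→ₗ[ℝ] ℝ →ₗ[ℝ] V [⋀^Fin l]→ₗ[ℝ] ℝ →ₗ[ℝ] V [⋀^Fin m]→ₗ[ℝ] ℝ :=
  LinearMap.mk₂ ℝ (wedgeAlt h)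
    (fun a a' b => by
      ext v
      simp only [wedgeAlt_apply, AlternatingMap.add_apply, add_mul, antisymSum_add, mul_add])
    (fun c a b => by
      ext v
      simp only [wedgeAlt_apply, AlternatingMap.smul_apply, smul_eq_mul, mul_assoc,
        antisymSum_const_mul, mul_left_comm _ c])
    (fun a b b' => by
      ext v
      simp only [wedgeAlt_apply, AlternatingMap.add_apply, mul_add, antisymSum_add])
    (fun c a b => by
      ext v
      simp only [wedgeAlt_apply, AlternatingMap.smul_apply, smul_eq_mul, antisymSum_const_mul,
        mul_left_comm _ c])

theorem wedgeBilin_apply (h : k + l = m) (a : V [⋀^Fin k]→ₗ[ℝ] ℝ) (b : V [⋀^Fin l]→ₗ[ℝ] ℝ) :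
    wedgeBilin h a b = wedgeAlt h a b := rfl

theorem wedgeAlt_compLinearMap {W : Type*} [AddCommGroup W] [Module ℝ W] (h : k + l = m)
    (a : V [⋀^Fin k]→ₗ[ℝ] ℝ) (b : V [⋀^Fin l]→ₗ[ℝ] ℝ) (f : W →ₗ[ℝ] V) :
    wedgeAlt h (a.compLinearMap f) (b.compLinearMap f) = (wedgeAlt h a b).compLinearMap f := by
  ext v
  simp only [wedgeAlt_apply, AlternatingMap.compLinearMap_apply]
  rfl

/-- The permutation of the `m = k + l` indices which exchanges the two blocks. -/
def blockSwap (h : k + l = m) : Equiv.Perm (Fin m) :=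
  (blockEquiv ((Nat.add_comm l k).trans h)).symm.trans ((Equiv.sumComm _ _).trans (blockEquiv h))

theorem blockSwap_inl (h : k + l = m) (j : Fin l) :
    blockSwap h (blockEquiv ((Nat.add_comm l k).trans h) (.inl j)) = blockEquiv h (.inr j) := by
  simp [blockSwap]

theorem blockSwap_inr (h : k + l = m) (i : Fin k) :
    blockSwap h (blockEquiv ((Nat.add_comm l k).trans h) (.inr i)) = blockEquiv h (.inl i) := by
  simp [blockSwap]

theorem finRotate_pow_val (m j : ℕ) (i : Fin m) :
    (((finRotate m) ^ j) i : ℕ) = (i + j) % m := by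
  obtain _ | m := m
  · exact i.elim0
  induction j with
  | zero => simp [Nat.mod_eq_of_lt i.2]
  | succ j ih =>
    rw [pow_succ', Equiv.Perm.mul_apply, finRotate_apply, Fin.val_add, ih, Fin.val_one',
      ← Nat.add_mod, add_assoc]

theorem blockSwap_eq_finRotate_pow (h : k + l = m) : blockSwap h = finRotate m ^ k := by
  ext i
  rw [finRotate_pow_val]
  obtain ⟨j | j, rfl⟩ := (blockEquiv ((Nat.add_comm l k).trans h)).surjective i
  · rw [blockSwap_inl, blockEquiv_inl_val, blockEquiv_inr_val, Nat.mod_eq_of_lt (by omega),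
      add_comm]
  · rw [blockSwap_inr, blockEquiv_inl_val, blockEquiv_inr_val,
      show l + j + k = j + m by omega, Nat.add_mod_right, Nat.mod_eq_of_lt (by omega)]

theorem sign_blockSwap (h : k + l = m) : Equiv.Perm.sign (blockSwap h) = (-1) ^ (k * l) := by
  rw [blockSwap_eq_finRotate_pow, map_pow, sign_finRotate, ← pow_mul]
  obtain _ | k := k
  · simp
  · rw [show (m - 1) * (k + 1) = (k + 1) * l + k * (k + 1) by
      rw [show m - 1 = k + l by omega]; ring, pow_add, (Nat.even_mul_succ_self k).neg_one_pow,
      mul_one]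

theorem wedgeAlt_comm (h : k + l = m) (a : V [⋀^Fin k]→ₗ[ℝ] ℝ) (b : V [⋀^Fin l]→ₗ[ℝ] ℝ) :
    wedgeAlt h a b = (-1 : ℝ) ^ (k * l) • wedgeAlt ((Nat.add_comm l k).trans h) b a := by
  ext v
  have hswap := antisymSum_comp_perm (fun u : Fin m → V =>
    b (fun j => u (blockEquiv ((Nat.add_comm l k).trans h) (.inl j))) *
      a (fun i => u (blockEquiv ((Nat.add_comm l k).trans h) (.inr i)))) (blockSwap h) v
  simp only [Function.comp_apply, blockSwap_inl, blockSwap_inr, sign_blockSwap] at hswap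
  rw [AlternatingMap.smul_apply, smul_eq_mul, wedgeAlt_apply, wedgeAlt_apply]
  simp only [mul_comm (a _)]
  rw [hswap]
  push_cast
  ring

theorem factorial_mul_wedgeAlt_alternatizeUncurryFin_left (h : k + l = m)
    (A : V →ₗ[ℝ] V [⋀^Fin k]→ₗ[ℝ] ℝ) (b : V [⋀^Fin l]→ₗ[ℝ] ℝ) (v : Fin (m + 1) → V) :
    ((k.factorial : ℝ) * l.factorial) *
        wedgeAlt (by omega : k + 1 + l = m + 1) (AlternatingMap.alternatizeUncurryFin A) b v =
      antisymSum (fun u => A (u 0) (fun i => Fin.tail u (blockEquiv h (.inl i))) *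
        b (fun j => Fin.tail u (blockEquiv h (.inr j)))) v := by
  have h' : k + 1 + l = m + 1 := by omega
  have hwedge := factorial_mul_wedgeAlt_apply h' (AlternatingMap.alternatizeUncurryFin A) b v
  have hinr (u : Fin (m + 1) → V) (j : Fin l) :
      Fin.tail u (blockEquiv h (.inr j)) = u (blockEquiv h' (.inr j)) :=
    congrArg u (Fin.ext (by simp only [Fin.val_succ, blockEquiv_inr_val]; omega))
  simp only [hinr]
  let Φ : (Fin (m + 1) → V) → ℝ := fun u =>
    A (u 0) (fun i => Fin.tail u (blockEquiv h (.inl i))) *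
      b (fun j => u (blockEquiv h' (.inr j)))
  have hΦ := antisymSum_sum_sign_mul Φ
    (fun i : Fin (k + 1) => blockPerm h' i.cycleRange.symm 1) v
  have hsum (u : Fin (m + 1) → V) :
      ∑ i : Fin (k + 1), ((Equiv.Perm.sign (blockPerm h' i.cycleRange.symm 1) : ℤ) : ℝ) *
          Φ (u ∘ blockPerm h' i.cycleRange.symm 1) =
        AlternatingMap.alternatizeUncurryFin A (fun i => u (blockEquiv h' (.inl i))) *
          b (fun j => u (blockEquiv h' (.inr j))) := by
    rw [alternatizeUncurryFin_eq_sum_sign, Finset.sum_mul]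
    refine Finset.sum_congr rfl fun i _ => ?_
    rw [sign_blockPerm, Equiv.Perm.sign_one, mul_one, mul_assoc]
    have h0 : (0 : Fin (m + 1)) = blockEquiv h' (.inl 0) := rfl
    have hinl (i : Fin k) : (blockEquiv h (.inl i)).succ = blockEquiv h' (.inl i.succ) := rfl
    simp only [Φ, Fin.tail_def, Function.comp_apply, h0, hinl, blockPerm_inl, blockPerm_inr,
      Equiv.Perm.one_apply]
  simp only [hsum] at hΦ
  rw [hΦ, Fintype.card_fin, Nat.factorial_succ] at hwedge
  have hk : ((k + 1 : ℕ) : ℝ) ≠ 0 := by positivity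
  apply mul_left_cancel₀ hk
  rw [← hwedge]
  push_cast
  ring

theorem factorial_mul_alternatizeUncurryFin_wedgeBilin_flip (h : k + l = m)
    (A : V →ₗ[ℝ] V [⋀^Fin k]→ₗ[ℝ] ℝ) (b : V [⋀^Fin l]→ₗ[ℝ] ℝ) (v : Fin (m + 1) → V) :
    ((k.factorial : ℝ) * l.factorial) *
        AlternatingMap.alternatizeUncurryFin ((wedgeBilin h).flip b ∘ₗ A) v =
      antisymSum (fun u => A (u 0) (fun i => Fin.tail u (blockEquiv h (.inl i))) *
        b (fun j => Fin.tail u (blockEquiv h (.inr j)))) v := by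
  have hm : (m.factorial : ℝ) ≠ 0 := by positivity
  apply mul_left_cancel₀ hm
  rw [← antisymSum_antisymSum_tail fun x w => A x (fun i => w (blockEquiv h (.inl i))) *
    b (fun j => w (blockEquiv h (.inr j))), mul_left_comm, factorial_mul_alternatizeUncurryFin,
    ← antisymSum_const_mul]
  congr 1
  funext u
  exact factorial_mul_wedgeAlt_apply h (A (u 0)) b (Fin.tail u)

theorem wedgeAlt_alternatizeUncurryFin_left (h : k + l = m) (A : V →ₗ[ℝ] V [⋀^Fin k]→ₗ[ℝ] ℝ)
    (b : V [⋀^Fin l]→ₗ[ℝ] ℝ) :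
    wedgeAlt (by omega : k + 1 + l = m + 1) (AlternatingMap.alternatizeUncurryFin A) b =
      AlternatingMap.alternatizeUncurryFin ((wedgeBilin h).flip b ∘ₗ A) := by
  ext v
  have hkl : ((k.factorial : ℝ) * l.factorial) ≠ 0 := by positivity
  apply mul_left_cancel₀ hkl
  rw [factorial_mul_wedgeAlt_alternatizeUncurryFin_left h,
    factorial_mul_alternatizeUncurryFin_wedgeBilin_flip]

theorem wedgeAlt_alternatizeUncurryFin_right (h : k + l = m) (a : V [⋀^Fin k]→ₗ[ℝ] ℝ)
    (B : V →ₗ[ℝ] V [⋀^Fin l]→ₗ[ℝ] ℝ) :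
    (-1 : ℝ) ^ k • wedgeAlt (by omega : k + (l + 1) = m + 1) a
        (AlternatingMap.alternatizeUncurryFin B) =
      AlternatingMap.alternatizeUncurryFin (wedgeBilin h a ∘ₗ B) := by
  have hcomm : wedgeBilin h a ∘ₗ B =
      (-1 : ℝ) ^ (k * l) • ((wedgeBilin ((Nat.add_comm l k).trans h)).flip a ∘ₗ B) := by
    ext1 x
    exact wedgeAlt_comm h a (B x)
  rw [hcomm, AlternatingMap.alternatizeUncurryFin_smul, wedgeAlt_comm, smul_smul,
    wedgeAlt_alternatizeUncurryFin_left ((Nat.add_comm l k).trans h)]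
  congr 1
  rw [← pow_add, show k + k * (l + 1) = k * l + 2 * k by ring, pow_add, pow_mul _ 2, neg_one_sq,
    one_pow, mul_one]

/-- The tensor product `x ↦ t x • a`, whose antisymmetrization is the wedge product of the
covector `t` and the form `a`. -/
def tensorAlt (t : V [⋀^Fin 1]→ₗ[ℝ] ℝ) (a : V [⋀^Fin k]→ₗ[ℝ] ℝ) :
    V →ₗ[ℝ] V [⋀^Fin k]→ₗ[ℝ] ℝ :=
  LinearMap.smulRight ((AlternatingMap.ofSubsingleton ℝ V ℝ (0 : Fin 1)).symm t) a

theorem wedgeAlt_one_left (t : V [⋀^Fin 1]→ₗ[ℝ] ℝ) (a : V [⋀^Fin k]→ₗ[ℝ] ℝ) :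
    wedgeAlt (Nat.add_comm 1 k) t a = AlternatingMap.alternatizeUncurryFin (tensorAlt t a) := by
  ext v
  have hk : (k.factorial : ℝ) ≠ 0 := by positivity
  apply mul_left_cancel₀ hk
  have h := factorial_mul_wedgeAlt_apply (Nat.add_comm 1 k) t a v
  rw [Nat.factorial_one, Nat.cast_one, one_mul] at h
  rw [h, factorial_mul_alternatizeUncurryFin]
  congr 1
  funext u
  have htail : (fun j => u (blockEquiv (Nat.add_comm 1 k) (.inr j))) = Fin.tail u :=
    funext fun j => congrArg u (Fin.ext (by
      rw [blockEquiv_inr_val, Fin.val_succ, Nat.add_comm]))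
  have hhead : (fun i => u (blockEquiv (Nat.add_comm 1 k) (.inl i))) = fun _ => u 0 :=
    funext fun i => congrArg u (Fin.ext (by
      rw [blockEquiv_inl_val, Fin.val_eq_zero, Fin.val_zero]))
  rw [htail, hhead]
  rfl

end Wedge

section InnerAlt

variable {k : ℕ} {V : Type*} [NormedAddCommGroup V] [InnerProductSpace ℝ V]

theorem alternatingMap_apply_eq_sum_inner {ι : Type*} [Fintype ι] (e : OrthonormalBasis ι ℝ V)
    (a : V [⋀^Fin k]→ₗ[ℝ] ℝ) (v : Fin k → V) :
    a v = ∑ I : Fin k → ι, (∏ i, inner ℝ (e (I i)) (v i)) * a (fun i => e (I i)) := by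
  classical
  conv_lhs => rw [show v = fun i => ∑ j, inner ℝ (e j) (v i) • e j from
    funext fun i => (e.sum_repr' (v i)).symm]
  refine (a.toMultilinearMap.map_sum fun i j => inner ℝ (e j) (v i) • e j).trans
    (Finset.sum_congr rfl fun I _ => ?_)
  exact a.toMultilinearMap.map_smul_univ _ _

variable [FiniteDimensional ℝ V]

theorem innerAlt_eq_sum {ι : Type*} [Fintype ι] (e : OrthonormalBasis ι ℝ V)
    (a b : V [⋀^Fin k]→ₗ[ℝ] ℝ) :
    innerAlt a b = (k.factorial : ℝ)⁻¹ * ∑ I : Fin k → ι,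
      a (fun j => e (I j)) * b (fun j => e (I j)) := by
  set f := stdOrthonormalBasis ℝ V with hf
  rw [innerAlt, ← hf]
  congr 1
  calc ∑ I : Fin k → Fin (Module.finrank ℝ V), a (fun j => f (I j)) * b (fun j => f (I j))
    _ = ∑ I : Fin k → Fin (Module.finrank ℝ V), ∑ J : Fin k → ι, a (fun j => e (J j)) *
          ((∏ i, inner ℝ (e (J i)) (f (I i))) * b (fun j => f (I j))) :=
        Finset.sum_congr rfl fun I _ => by
          rw [alternatingMap_apply_eq_sum_inner e a, Finset.sum_mul]
          exact Finset.sum_congr rfl fun J _ => by ring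
    _ = ∑ J : Fin k → ι, a (fun j => e (J j)) *
          ∑ I : Fin k → Fin (Module.finrank ℝ V),
            (∏ i, inner ℝ (f (I i)) (e (J i))) * b (fun j => f (I j)) := by
        rw [Finset.sum_comm]
        simp only [Finset.mul_sum, real_inner_comm]
    _ = ∑ J : Fin k → ι, a (fun j => e (J j)) * b (fun j => e (J j)) :=
        Finset.sum_congr rfl fun J _ => by rw [← alternatingMap_apply_eq_sum_inner f b]

theorem innerAlt_comm (a b : V [⋀^Fin k]→ₗ[ℝ] ℝ) : innerAlt a b = innerAlt b a := by
  simp only [innerAlt, mul_comm]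

theorem innerAlt_smul_left (r : ℝ) (a b : V [⋀^Fin k]→ₗ[ℝ] ℝ) :
    innerAlt (r • a) b = r * innerAlt a b := by
  simp only [innerAlt, AlternatingMap.smul_apply, smul_eq_mul, mul_assoc, ← Finset.mul_sum,
    mul_left_comm _ r]

theorem innerAlt_smul_right (r : ℝ) (a b : V [⋀^Fin k]→ₗ[ℝ] ℝ) :
    innerAlt a (r • b) = r * innerAlt a b := by
  rw [innerAlt_comm, innerAlt_smul_left, innerAlt_comm]

theorem innerAlt_add_left (a b c : V [⋀^Fin k]→ₗ[ℝ] ℝ) :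
    innerAlt (a + b) c = innerAlt a c + innerAlt b c := by
  simp only [innerAlt, AlternatingMap.add_apply, add_mul, mul_add, Finset.sum_add_distrib]

theorem innerAlt_sub_right (a b c : V [⋀^Fin k]→ₗ[ℝ] ℝ) :
    innerAlt a (b - c) = innerAlt a b - innerAlt a c := by
  simp only [innerAlt, AlternatingMap.sub_apply, mul_sub, Finset.sum_sub_distrib]

theorem innerAlt_self_nonneg (a : V [⋀^Fin k]→ₗ[ℝ] ℝ) : 0 ≤ innerAlt a a :=
  mul_nonneg (by positivity) (Finset.sum_nonneg fun _ _ => mul_self_nonneg _)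

theorem innerAlt_self_eq_zero {a : V [⋀^Fin k]→ₗ[ℝ] ℝ} : innerAlt a a = 0 ↔ a = 0 := by
  refine ⟨fun ha => ?_, fun ha => by simp [ha, innerAlt]⟩
  have hsum := (mul_eq_zero.1 ha).resolve_left (by positivity)
  rw [Finset.sum_eq_zero_iff_of_nonneg fun _ _ => mul_self_nonneg _] at hsum
  refine Module.Basis.ext_alternating (stdOrthonormalBasis ℝ V).toBasis fun I _ => ?_
  simpa using hsum I (Finset.mem_univ I)

end InnerAlt

section HodgeStar

variable {p k l : ℕ} {V : Type*}

section Contraction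

variable [AddCommGroup V] [Module ℝ V]

theorem alternatingMap_sum_apply {ι : Type*} (s : Finset ι) (f : ι → V [⋀^Fin k]→ₗ[ℝ] ℝ)
    (v : Fin k → V) : (∑ i ∈ s, f i) v = ∑ i ∈ s, f i v :=
  map_sum ({ toFun := fun a => a v, map_zero' := rfl, map_add' := fun _ _ => rfl } :
    V [⋀^Fin k]→ₗ[ℝ] ℝ →+ ℝ) f s

/-- The contraction of an alternating form with `k` vectors, which are inserted into its first
block of arguments. -/
def contractLeft (h : k + l = p) (χ : V [⋀^Fin p]→ₗ[ℝ] ℝ) (w : Fin k → V) :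
    V [⋀^Fin l]→ₗ[ℝ] ℝ :=
  { (χ.domDomCongr (blockEquiv h).symm).toMultilinearMap.currySum w with
    map_eq_zero_of_eq' := fun v i j hv hij =>
      (χ.domDomCongr (blockEquiv h).symm).map_eq_zero_of_eq (Sum.elim w v)
        (i := .inr i) (j := .inr j) hv (Sum.inr_injective.ne hij) }

theorem contractLeft_apply (h : k + l = p) (χ : V [⋀^Fin p]→ₗ[ℝ] ℝ) (w : Fin k → V)
    (v : Fin l → V) : contractLeft h χ w v = χ (Sum.elim w v ∘ (blockEquiv h).symm) :=
  rfl

theorem contractLeft_apply_comp_inr (h : k + l = p) (χ : V [⋀^Fin p]→ₗ[ℝ] ℝ)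
    (v : Fin k ⊕ Fin l → V) :
    contractLeft h χ (v ∘ Sum.inl) (v ∘ Sum.inr) = χ (v ∘ (blockEquiv h).symm) := by
  rw [contractLeft_apply, Sum.elim_comp_inl_inr]

theorem contractLeft_comp_perm (h : k + l = p) (χ : V [⋀^Fin p]→ₗ[ℝ] ℝ) (w : Fin k → V)
    (v : Fin l → V) (τ : Equiv.Perm (Fin k)) :
    contractLeft h χ (w ∘ τ) v = ((Equiv.Perm.sign τ : ℤ) : ℝ) * contractLeft h χ w v := by
  have hτ : Sum.elim (w ∘ τ) v ∘ (blockEquiv h).symm =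
      (Sum.elim w v ∘ (blockEquiv h).symm) ∘ blockPerm h τ 1 := by
    funext i
    obtain ⟨i | i, rfl⟩ := (blockEquiv h).surjective i
    · simp [blockPerm_inl]
    · simp [blockPerm_inr]
  rw [contractLeft_apply, hτ, alternatingMap_comp_perm, sign_blockPerm, Equiv.Perm.sign_one,
    mul_one, contractLeft_apply]

theorem contractLeft_comp_eq_zero {ι : Type*} (e : ι → V) (h : k + l = p)
    (χ : V [⋀^Fin p]→ₗ[ℝ] ℝ) (I : Fin k → ι)
    (J : Fin l → ι) (hIJ : ¬ Function.Injective (Sum.elim I J)) :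
    contractLeft h χ (e ∘ I) (e ∘ J) = 0 := by
  rw [contractLeft_apply, ← Sum.comp_elim]
  refine χ.map_eq_zero_of_not_injective _ fun hinj => hIJ ?_
  exact ((Equiv.injective_comp (blockEquiv h).symm _).1 hinj).of_comp

end Contraction

section Extension

variable {κ ι X : Type*} [Fintype ι] [Fintype X]

theorem exists_equiv_sum_extending [Fintype κ]
    (hcard : Fintype.card ι + Fintype.card κ = Fintype.card X)
    {I : κ → X} (hI : Function.Injective I) : ∃ s : ι ⊕ κ ≃ X, s ∘ Sum.inr = I := by
  classical
  have hcompl : Fintype.card ι = Fintype.card ↥(Set.range I)ᶜ := by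
    rw [Fintype.card_compl_set, Set.card_range_of_injective hI]
    omega
  refine ⟨(Equiv.sumComm ι κ).trans (((Equiv.ofInjective I hI).sumCongr
    (Fintype.equivOfCardEq hcompl)).trans (Equiv.Set.sumCompl (Set.range I))), ?_⟩
  funext j
  simp

variable [DecidableEq ι]

theorem sum_eq_factorial_mul_of_comp_perm (s : ι ⊕ κ ≃ X) (G : (ι → X) → ℝ)
    (hG : ∀ I, ¬ Function.Injective (Sum.elim I (s ∘ Sum.inr)) → G I = 0)
    (hperm : ∀ τ : Equiv.Perm ι, G (s ∘ Sum.inl ∘ τ) = G (s ∘ Sum.inl)) :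
    ∑ I, G I = (Fintype.card ι).factorial * G (s ∘ Sum.inl) := by
  have hinj : Function.Injective fun τ : Equiv.Perm ι => s ∘ Sum.inl ∘ τ :=
    (s.injective.comp Sum.inl_injective).comp_left.comp DFunLike.coe_injective
  rw [← Fintype.sum_of_injective _ hinj (fun _ => G (s ∘ Sum.inl)) G ?_ fun τ => (hperm τ).symm,
    Finset.sum_const, Finset.card_univ, Fintype.card_perm, nsmul_eq_mul]
  intro I hI
  refine hG I fun hIs => hI ?_
  have hmem (i : ι) : ∃ j, s (Sum.inl j) = I i := by
    obtain ⟨j | j, hj⟩ := s.surjective (I i)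
    · exact ⟨j, hj⟩
    · exact absurd (hIs (a₁ := .inl i) (a₂ := .inr j) hj.symm) Sum.inl_ne_inr
  choose τ hτ using hmem
  have hτinj : Function.Injective τ := fun i j hij =>
    Sum.inl_injective (hIs ((hτ i).symm.trans ((congrArg (s ∘ Sum.inl) hij).trans (hτ j))))
  exact ⟨Equiv.ofBijective τ (Finite.injective_iff_bijective.1 hτinj), funext hτ⟩

end Extension

variable [NormedAddCommGroup V] [InnerProductSpace ℝ V] [Fact (Module.finrank ℝ V = p)]
  (o : Orientation ℝ V (Fin p)) (e : OrthonormalBasis (Fin p) ℝ V)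

theorem volumeForm_apply_mul_self : o.volumeForm e * o.volumeForm e = 1 := by
  rw [← abs_mul_abs_self, o.abs_volumeForm_apply_of_orthonormal, one_mul]

theorem eq_smul_volumeForm (τ : V [⋀^Fin p]→ₗ[ℝ] ℝ) :
    τ = (τ e * o.volumeForm e) • o.volumeForm := by
  have hτ := τ.eq_smul_basis_det e.toBasis
  have hχ := o.volumeForm.eq_smul_basis_det e.toBasis
  rw [e.coe_toBasis] at hτ hχ
  calc τ = (τ e * (o.volumeForm e * o.volumeForm e)) • e.toBasis.det := by
        rw [volumeForm_apply_mul_self, mul_one, ← hτ]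
    _ = (τ e * o.volumeForm e) • o.volumeForm e • e.toBasis.det := by
        rw [smul_smul, mul_assoc]
    _ = (τ e * o.volumeForm e) • o.volumeForm := by rw [← hχ]

/-- The Hodge star operator in terms of an orthonormal basis `e`: up to the factor `1 / k!`, the
sum over the tuples `I` of `b (e ∘ I)` times the contraction of the volume form with `e ∘ I`. -/
def basisStar (h : k + l = p) (b : V [⋀^Fin k]→ₗ[ℝ] ℝ) : V [⋀^Fin l]→ₗ[ℝ] ℝ :=
  (k.factorial : ℝ)⁻¹ • ∑ I : Fin k → Fin p, b (e ∘ I) • contractLeft h o.volumeForm (e ∘ I)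

theorem basisStar_apply (h : k + l = p) (b : V [⋀^Fin k]→ₗ[ℝ] ℝ) (v : Fin l → V) :
    basisStar o e h b v = (k.factorial : ℝ)⁻¹ *
      ∑ I : Fin k → Fin p, b (e ∘ I) * contractLeft h o.volumeForm (e ∘ I) v := by
  simp only [basisStar, AlternatingMap.smul_apply, alternatingMap_sum_apply, smul_eq_mul]

theorem basisStar_apply_basis (h : k + l = p) (b : V [⋀^Fin k]→ₗ[ℝ] ℝ)
    (s : Fin k ⊕ Fin l ≃ Fin p) :
    basisStar o e h b (e ∘ s ∘ Sum.inr) =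
      o.volumeForm (e ∘ s ∘ (blockEquiv h).symm) * b (e ∘ s ∘ Sum.inl) := by
  have hsum := sum_eq_factorial_mul_of_comp_perm s
    (fun I => b (e ∘ I) * contractLeft h o.volumeForm (e ∘ I) (e ∘ s ∘ Sum.inr))
    (fun I hI => by rw [contractLeft_comp_eq_zero e h _ I _ hI, mul_zero])
    (fun τ => by
      rw [← Function.comp_assoc s, ← Function.comp_assoc e, alternatingMap_comp_perm,
        contractLeft_comp_perm, mul_mul_mul_comm, sign_mul_self, one_mul])
  rw [basisStar_apply, hsum, Fintype.card_fin, inv_mul_cancel_left₀ (by positivity), mul_comm]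
  exact congrArg (· * _) (contractLeft_apply_comp_inr h o.volumeForm (e ∘ s))

theorem basisStar_basisStar (h : k + l = p) (b : V [⋀^Fin k]→ₗ[ℝ] ℝ) :
    basisStar o e ((Nat.add_comm l k).trans h) (basisStar o e h b) = (-1 : ℝ) ^ (k * l) • b := by
  refine Module.Basis.ext_alternating e.toBasis fun I hI => ?_
  obtain ⟨s, rfl⟩ := exists_equiv_sum_extending (ι := Fin l) (by simp; omega) hI
  let t : Fin k ⊕ Fin l ≃ Fin p := (Equiv.sumComm _ _).trans s
  let σ : Equiv.Perm (Fin p) := (blockEquiv h).symm.trans t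
  have hswap : e ∘ s ∘ (blockEquiv ((Nat.add_comm l k).trans h)).symm =
      (e ∘ σ) ∘ blockSwap h := by
    funext i
    simp [σ, t, blockSwap]
  have hσ : o.volumeForm (e ∘ σ) * o.volumeForm (e ∘ σ) = 1 := by
    simpa using volumeForm_apply_mul_self o (e.reindex σ.symm)
  have hstar : basisStar o e h b (e ∘ s ∘ Sum.inl) =
      o.volumeForm (e ∘ σ) * b (e ∘ s ∘ Sum.inr) := basisStar_apply_basis o e h b t
  have hmain : basisStar o e ((Nat.add_comm l k).trans h) (basisStar o e h b)
      (e ∘ s ∘ Sum.inr) = (-1 : ℝ) ^ (k * l) * b (e ∘ s ∘ Sum.inr) := by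
    rw [basisStar_apply_basis, hstar, hswap, alternatingMap_comp_perm, sign_blockSwap, ← mul_assoc,
      mul_assoc _ _ (o.volumeForm (e ∘ σ)), hσ, mul_one]
    push_cast
    rfl
  simpa [Function.comp_def] using hmain

theorem wedgeAlt_apply_basis_mul_volumeForm (h : k + l = p) (a : V [⋀^Fin k]→ₗ[ℝ] ℝ)
    (b : V [⋀^Fin l]→ₗ[ℝ] ℝ) :
    wedgeAlt h a b e * o.volumeForm e = ((k.factorial : ℝ) * l.factorial)⁻¹ *
      ∑ I : Fin k → Fin p, ∑ J : Fin l → Fin p,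
        a (e ∘ I) * b (e ∘ J) * contractLeft h o.volumeForm (e ∘ I) (e ∘ J) := by
  rw [wedgeAlt_apply, mul_assoc]
  congr 1
  let H : (Fin k ⊕ Fin l → Fin p) → ℝ := fun K => a (e ∘ K ∘ Sum.inl) * b (e ∘ K ∘ Sum.inr) *
    o.volumeForm (e ∘ K ∘ (blockEquiv h).symm)
  have hH (I : Fin k → Fin p) (J : Fin l → Fin p) :
      a (e ∘ I) * b (e ∘ J) * contractLeft h o.volumeForm (e ∘ I) (e ∘ J) =
        H (Sum.elim I J) := by
    simp only [H, Sum.elim_comp_inl, Sum.elim_comp_inr, contractLeft_apply, ← Sum.comp_elim,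
      Function.comp_assoc]
  simp only [hH]
  rw [← Fintype.sum_prod_type']
  change _ = ∑ q, H ((Equiv.sumArrowEquivProdArrow _ _ _).symm q)
  rw [Equiv.sum_comp (Equiv.sumArrowEquivProdArrow _ _ _).symm H, antisymSum, Finset.sum_mul]
  refine Fintype.sum_of_injective (fun s : Equiv.Perm (Fin p) => s ∘ blockEquiv h)
    ((blockEquiv h).surjective.injective_comp_right.comp DFunLike.coe_injective) _ _ ?_ ?_
  · intro K hK
    have hχ : o.volumeForm (e ∘ K ∘ (blockEquiv h).symm) = 0 :=
      o.volumeForm.map_eq_zero_of_not_injective _ fun hinj => hK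
        ⟨Equiv.ofBijective _ (Finite.injective_iff_bijective.1 hinj.of_comp), by
          funext i
          simp⟩
    simp only [H, hχ, mul_zero]
  · intro s
    have hs : e ∘ (s ∘ blockEquiv h) ∘ (blockEquiv h).symm = e ∘ s := by
      funext i
      simp
    simp only [H, hs, alternatingMap_comp_perm o.volumeForm e s]
    rw [mul_assoc, mul_left_comm]
    rfl

variable [FiniteDimensional ℝ V]

theorem volumeForm_ne_zero : o.volumeForm ≠ 0 := by
  let e := (stdOrthonormalBasis ℝ V).reindex (finCongr (Fact.out : Module.finrank ℝ V = p))
  intro h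
  have hself := volumeForm_apply_mul_self o e
  rw [h, AlternatingMap.zero_apply, zero_mul] at hself
  exact zero_ne_one hself

theorem wedgeAlt_eq_innerAlt_basisStar_smul (h : k + l = p) (a : V [⋀^Fin k]→ₗ[ℝ] ℝ)
    (b : V [⋀^Fin l]→ₗ[ℝ] ℝ) :
    wedgeAlt h a b = innerAlt (basisStar o e h a) b • o.volumeForm := by
  rw [eq_smul_volumeForm o e (wedgeAlt h a b), wedgeAlt_apply_basis_mul_volumeForm,
    innerAlt_eq_sum e, Finset.sum_comm, mul_inv_rev, mul_assoc]
  congr 2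
  rw [Finset.mul_sum]
  refine Finset.sum_congr rfl fun J _ => ?_
  rw [basisStar_apply, mul_assoc, Finset.sum_mul]
  congr 1
  exact Finset.sum_congr rfl fun I _ => mul_right_comm _ _ _

theorem isStarAlt_basisStar (h : k + l = p) (b : V [⋀^Fin k]→ₗ[ℝ] ℝ) :
    IsStarAlt o h b (basisStar o e h b) := by
  intro a
  rw [wedgeAlt_comm, wedgeAlt_eq_innerAlt_basisStar_smul o e, basisStar_basisStar, smul_smul,
    innerAlt_smul_left, ← mul_assoc, ← mul_pow, neg_one_mul, neg_neg, one_pow, one_mul,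
    innerAlt_comm]

theorem isStarAlt_iff (h : k + l = p) (b : V [⋀^Fin k]→ₗ[ℝ] ℝ) (c : V [⋀^Fin l]→ₗ[ℝ] ℝ) :
    IsStarAlt o h b c ↔ c = basisStar o e h b := by
  refine ⟨fun hc => ?_, fun hc => hc ▸ isStarAlt_basisStar o e h b⟩
  have horth (a : V [⋀^Fin k]→ₗ[ℝ] ℝ) :
      innerAlt (basisStar o e h a) (c - basisStar o e h b) = 0 := by
    have hwedge := (hc a).trans (isStarAlt_basisStar o e h b a).symm
    rw [wedgeAlt_eq_innerAlt_basisStar_smul o e, wedgeAlt_eq_innerAlt_basisStar_smul o e] at hwedge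
    rw [innerAlt_sub_right, smul_left_injective ℝ (volumeForm_ne_zero o) hwedge, sub_self]
  have hself := horth (basisStar o e ((Nat.add_comm l k).trans h) (c - basisStar o e h b))
  rw [basisStar_basisStar, innerAlt_smul_left] at hself
  exact sub_eq_zero.1 (innerAlt_self_eq_zero.1 ((mul_eq_zero.1 hself).resolve_left (by simp)))

theorem existsUnique_isStarAlt (h : k + l = p) (b : V [⋀^Fin k]→ₗ[ℝ] ℝ) :
    ∃! c, IsStarAlt o h b c := by
  simp only [isStarAlt_iff o (stdOrthonormalBasis ℝ V |>.reindex (finCongr Fact.out)),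
    existsUnique_eq]

theorem isStarAlt_starAlt (h : k + l = p) (b : V [⋀^Fin k]→ₗ[ℝ] ℝ) :
    IsStarAlt o h b (starAlt o h b) := by
  have hex := (existsUnique_isStarAlt o h b).exists
  rw [starAlt, dif_pos hex]
  exact hex.choose_spec

theorem starAlt_eq_basisStar (h : k + l = p) (b : V [⋀^Fin k]→ₗ[ℝ] ℝ) :
    starAlt o h b = basisStar o e h b :=
  (isStarAlt_iff o e h b _).1 (isStarAlt_starAlt o h b)

theorem starAlt_starAlt (h : k + l = p) (b : V [⋀^Fin k]→ₗ[ℝ] ℝ) :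
    starAlt o ((Nat.add_comm l k).trans h) (starAlt o h b) = (-1 : ℝ) ^ (k * l) • b := by
  let e := (stdOrthonormalBasis ℝ V).reindex (finCongr (Fact.out : Module.finrank ℝ V = p))
  simp only [starAlt_eq_basisStar o e, basisStar_basisStar]

theorem starAlt_smul (h : k + l = p) (r : ℝ) (b : V [⋀^Fin k]→ₗ[ℝ] ℝ) :
    starAlt o h (r • b) = r • starAlt o h b := by
  refine ((existsUnique_isStarAlt o h (r • b)).unique (isStarAlt_starAlt o h _) fun a => ?_)
  rw [← wedgeBilin_apply, map_smul, wedgeBilin_apply, isStarAlt_starAlt o h b a,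
    innerAlt_smul_right, smul_smul]

theorem starAlt_add (h : k + l = p) (b c : V [⋀^Fin k]→ₗ[ℝ] ℝ) :
    starAlt o h (b + c) = starAlt o h b + starAlt o h c := by
  refine ((existsUnique_isStarAlt o h (b + c)).unique (isStarAlt_starAlt o h _) fun a => ?_)
  rw [← wedgeBilin_apply, map_add, wedgeBilin_apply, wedgeBilin_apply, isStarAlt_starAlt o h b a,
    isStarAlt_starAlt o h c a, innerAlt_comm a (b + c), innerAlt_add_left, add_smul,
    innerAlt_comm b, innerAlt_comm c]

end HodgeStar

section FormValued

variable {n k : ℕ} {E : Type*} [NormedAddCommGroup E] [NormedSpace ℝ E] {s : Set E}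
  {f : E → Model n [⋀^Fin k]→L[ℝ] ℝ}

theorem continuousAlternatingMap_apply_eq_sum (a : Model n [⋀^Fin k]→L[ℝ] ℝ)
    (v : Fin k → Model n) : a v = ∑ r : Fin k → Fin n,
      (∏ i, v i (r i)) * a (fun i => EuclideanSpace.basisFun (Fin n) ℝ (r i)) := by
  simpa [EuclideanSpace.inner_single_left] using
    alternatingMap_apply_eq_sum_inner (EuclideanSpace.basisFun (Fin n) ℝ) a.toAlternatingMap v

theorem contDiffOn_of_forall_apply
    (hf : ∀ v : Fin k → Model n, ContDiffOn ℝ ∞ (fun u => f u v) s) : ContDiffOn ℝ ∞ f s := by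
  let ev : (Model n [⋀^Fin k]→L[ℝ] ℝ) →ₗ[ℝ] ((Fin k → Fin n) → ℝ) :=
    { toFun := fun a r => a (fun i => EuclideanSpace.basisFun (Fin n) ℝ (r i))
      map_add' := fun a b => rfl
      map_smul' := fun c a => rfl }
  have ev_injective : Function.Injective ev := by
    intro a b hab
    ext v
    rw [continuousAlternatingMap_apply_eq_sum a, continuousAlternatingMap_apply_eq_sum b]
    exact Finset.sum_congr rfl fun r _ => congrArg _ (congrFun hab r)
  obtain ⟨g, hg⟩ :=
    LinearMap.exists_leftInverse_of_injective ev (LinearMap.ker_eq_bot.2 ev_injective)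
  have hfg : f = fun u => LinearMap.toContinuousLinearMap g (ev (f u)) :=
    funext fun u => (LinearMap.congr_fun hg (f u)).symm
  rw [hfg]
  exact (ContinuousLinearMap.contDiff _).comp_contDiffOn (contDiffOn_pi.2 fun r => hf _)

theorem contDiffOn_apply (hf : ContDiffOn ℝ ∞ f s) {v : Fin k → E → Model n}
    (hv : ∀ i, ContDiffOn ℝ ∞ (v i) s) : ContDiffOn ℝ ∞ (fun u => f u (fun i => v i u)) s := by
  simp only [fun u => continuousAlternatingMap_apply_eq_sum (f u) (fun i => v i u)]
  refine ContDiffOn.sum fun r _ => ContDiffOn.mul (contDiffOn_prod fun i _ => ?_) ?_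
  · exact (EuclideanSpace.proj (𝕜 := ℝ) (r i)).contDiff.comp_contDiffOn (hv i)
  · exact (ContinuousAlternatingMap.apply ℝ (Model n) ℝ _).contDiff.comp_contDiffOn hf

theorem contDiffOn_extDeriv {f : Model n → Model n [⋀^Fin k]→L[ℝ] ℝ} {s : Set (Model n)}
    (hs : IsOpen s) (hf : ContDiffOn ℝ ∞ f s) : ContDiffOn ℝ ∞ (extDeriv f) s :=
  ContDiff.comp_contDiffOn (g := ContinuousAlternatingMap.alternatizeUncurryFinCLM ℝ (Model n) ℝ)
    (ContinuousLinearMap.contDiff _) (hf.fderiv_of_isOpen hs (m := ∞) (by simp))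

end FormValued

section Charts

variable {n : ℕ} {M : Type*} [TopologicalSpace M] {φ ψ : OpenPartialHomeomorph M (Model n)}

theorem isOpen_transition (φ ψ : OpenPartialHomeomorph M (Model n)) :
    IsOpen (φ.target ∩ φ.symm ⁻¹' ψ.source) :=
  φ.isOpen_inter_preimage_symm ψ.open_source

variable [ChartedSpace (Model n) M]

theorem mdifferentiable_of_mem_maximalAtlas (hφ : φ ∈ IsManifold.maximalAtlas (𝓡 n) ∞ M) :
    φ.MDifferentiable (𝓡 n) (𝓡 n) :=
  ⟨(contMDiffOn_of_mem_maximalAtlas hφ).mdifferentiableOn (by simp),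
    (contMDiffOn_symm_of_mem_maximalAtlas hφ).mdifferentiableOn (by simp)⟩

theorem contDiffOn_transition (hφ : φ ∈ IsManifold.maximalAtlas (𝓡 n) ∞ M)
    (hψ : ψ ∈ IsManifold.maximalAtlas (𝓡 n) ∞ M) :
    ContDiffOn ℝ ∞ (ψ ∘ φ.symm) (φ.target ∩ φ.symm ⁻¹' ψ.source) := by
  rw [← contMDiffOn_iff_contDiffOn]
  exact (contMDiffOn_of_mem_maximalAtlas hψ).comp
    ((contMDiffOn_symm_of_mem_maximalAtlas hφ).mono Set.inter_subset_left) fun u hu => hu.2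

theorem contDiffOn_comp_symm (hφ : φ ∈ IsManifold.maximalAtlas (𝓡 n) ∞ M) {f : M → ℝ}
    (hf : ContMDiff (𝓡 n) 𝓘(ℝ, ℝ) ∞ f) : ContDiffOn ℝ ∞ (fun u => f (φ.symm u)) φ.target := by
  rw [← contMDiffOn_iff_contDiffOn]
  exact hf.comp_contMDiffOn (contMDiffOn_symm_of_mem_maximalAtlas hφ)

theorem chartDeriv_chartInvDeriv (hφ : φ ∈ IsManifold.maximalAtlas (𝓡 n) ∞ M) {u : Model n}
    (hu : u ∈ φ.target) (v : Model n) : chartDeriv φ (φ.symm u) (chartInvDeriv φ u v) = v :=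
  DFunLike.congr_fun ((mdifferentiable_of_mem_maximalAtlas hφ).comp_symm_deriv hu) v

theorem chartInvDeriv_chartDeriv (hφ : φ ∈ IsManifold.maximalAtlas (𝓡 n) ∞ M) {u : Model n}
    (hu : u ∈ φ.target) (v : TangentSpace (𝓡 n) (φ.symm u)) :
    chartInvDeriv φ u (chartDeriv φ (φ.symm u) v) = v := by
  have h := (mdifferentiable_of_mem_maximalAtlas hφ).symm_comp_deriv (φ.map_target hu)
  rw [φ.right_inv hu] at h
  exact DFunLike.congr_fun h v

theorem fderiv_transition_apply (hφ : φ ∈ IsManifold.maximalAtlas (𝓡 n) ∞ M)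
    (hψ : ψ ∈ IsManifold.maximalAtlas (𝓡 n) ∞ M) {u : Model n}
    (hu : u ∈ φ.target ∩ φ.symm ⁻¹' ψ.source) (v : Model n) :
    fderiv ℝ (ψ ∘ φ.symm) u v = chartDeriv ψ (φ.symm u) (chartInvDeriv φ u v) := by
  rw [← mfderiv_eq_fderiv]
  exact DFunLike.congr_fun (mfderiv_comp u
    ((mdifferentiable_of_mem_maximalAtlas hψ).mdifferentiableAt hu.2)
    ((mdifferentiable_of_mem_maximalAtlas hφ).mdifferentiableAt_symm hu.1)) v

theorem fderiv_transition_chartDeriv (hφ : φ ∈ IsManifold.maximalAtlas (𝓡 n) ∞ M)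
    (hψ : ψ ∈ IsManifold.maximalAtlas (𝓡 n) ∞ M) {u : Model n}
    (hu : u ∈ φ.target ∩ φ.symm ⁻¹' ψ.source) (v : TangentSpace (𝓡 n) (φ.symm u)) :
    fderiv ℝ (ψ ∘ φ.symm) u (chartDeriv φ (φ.symm u) v) = chartDeriv ψ (φ.symm u) v := by
  rw [fderiv_transition_apply hφ hψ hu, chartInvDeriv_chartDeriv hφ hu.1]

end Charts

section ChartMetric

variable {n : ℕ} {M : Type*} [TopologicalSpace M] [ChartedSpace (Model n) M]
  {φ : OpenPartialHomeomorph M (Model n)}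
  [RiemannianBundle (fun x : M => TangentSpace (𝓡 n) x)]

/-- The Riemannian metric in the chart `φ`: the inner product at `φ.symm u` of the constant
coordinate fields `v` and `w`. -/
def chartMetric (φ : OpenPartialHomeomorph M (Model n)) (u v w : Model n) : ℝ :=
  inner ℝ (chartInvDeriv φ u v) (chartInvDeriv φ u w)

theorem chartMetric_eq_sum (φ : OpenPartialHomeomorph M (Model n)) (u v w : Model n) :
    chartMetric φ u v w = ∑ i, ∑ j, v i * w j *
      chartMetric φ u (EuclideanSpace.basisFun (Fin n) ℝ i)
        (EuclideanSpace.basisFun (Fin n) ℝ j) := by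
  have hsum (v : Model n) : v = ∑ i, v i • EuclideanSpace.basisFun (Fin n) ℝ i := by
    simpa using ((EuclideanSpace.basisFun (Fin n) ℝ).sum_repr v).symm
  unfold chartMetric
  conv_lhs => rw [hsum v, hsum w]
  simp only [map_sum, map_smul, sum_inner, inner_sum, inner_smul_left, inner_smul_right,
    Finset.mul_sum]
  rw [Finset.sum_comm]
  exact Finset.sum_congr rfl fun i _ => Finset.sum_congr rfl fun j _ => by
    simp only [conj_trivial]
    ring

theorem chartMetric_chartDeriv (hφ : φ ∈ IsManifold.maximalAtlas (𝓡 n) ∞ M) {u : Model n}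
    (hu : u ∈ φ.target) (v w : TangentSpace (𝓡 n) (φ.symm u)) :
    chartMetric φ u (chartDeriv φ (φ.symm u) v) (chartDeriv φ (φ.symm u) w) = inner ℝ v w := by
  rw [chartMetric, chartInvDeriv_chartDeriv hφ hu, chartInvDeriv_chartDeriv hφ hu]

variable [IsManifold (𝓡 n) ∞ M]
  [IsContMDiffRiemannianBundle (𝓡 n) ∞ (Model n) (fun x : M => TangentSpace (𝓡 n) x)]

theorem contDiffOn_chartMetric_const (hφ : φ ∈ IsManifold.maximalAtlas (𝓡 n) ∞ M)
    (v w : Model n) : ContDiffOn ℝ ∞ (fun u => chartMetric φ u v w) φ.target := by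
  have contMDiffOn_coordinateField (v : Model n) : ContMDiffOn (𝓡 n) (𝓡 n).tangent ∞
      (fun u => (⟨φ.symm u, chartInvDeriv φ u v⟩ : TotalSpace (Model n)
        (fun x : M => TangentSpace (𝓡 n) x))) φ.target := by
    have htangentMap := (contMDiffOn_symm_of_mem_maximalAtlas hφ).contMDiffOn_tangentMapWithin
      (m := ∞) (by simp) φ.open_target.uniqueMDiffOn
    have hconst : ContMDiff (𝓡 n) (𝓡 n).tangent ∞
        (fun u : Model n => (⟨u, v⟩ : TangentBundle (𝓡 n) (Model n))) :=
      contMDiff_vectorSpace_iff_contDiff.2 contDiff_const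
    refine (htangentMap.comp hconst.contMDiffOn (s := φ.target) fun u hu => hu).congr
      fun u hu => ?_
    simp only [tangentMapWithin, chartInvDeriv, Function.comp_apply,
      mfderivWithin_of_isOpen φ.open_target hu]
    rfl
  rw [← contMDiffOn_iff_contDiffOn]
  exact (contMDiffOn_coordinateField v).inner_bundle (contMDiffOn_coordinateField w)

theorem contDiffOn_chartMetric (hφ : φ ∈ IsManifold.maximalAtlas (𝓡 n) ∞ M)
    {v w : Model n → Model n} (hv : ContDiffOn ℝ ∞ v φ.target) (hw : ContDiffOn ℝ ∞ w φ.target) :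
    ContDiffOn ℝ ∞ (fun u => chartMetric φ u (v u) (w u)) φ.target := by
  have hcoord {v : Model n → Model n} (hv : ContDiffOn ℝ ∞ v φ.target) (i : Fin n) :
      ContDiffOn ℝ ∞ (fun u => v u i) φ.target :=
    (EuclideanSpace.proj (𝕜 := ℝ) i).contDiff.comp_contDiffOn hv
  simp only [fun u => chartMetric_eq_sum φ u (v u) (w u)]
  exact ContDiffOn.sum fun i _ => ContDiffOn.sum fun j _ =>
    ((hcoord hv i).mul (hcoord hw j)).mul (contDiffOn_chartMetric_const hφ _ _)

end ChartMetric

section LeafForms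

variable {n p k l m : ℕ} {M : Type*} [TopologicalSpace M] [ChartedSpace (Model n) M]
  {φ ψ : OpenPartialHomeomorph M (Model n)}
  [RiemannianBundle (fun x : M => TangentSpace (𝓡 n) x)] {F : Foliation n M p}

theorem chartForm_apply (α : LeafForm F k) (φ : OpenPartialHomeomorph M (Model n)) (u : Model n)
    (v : Fin k → Model n) : chartForm α φ u v =
      α (φ.symm u) (fun i => (F.tangent (φ.symm u)).orthogonalProjectionOnto
        (chartInvDeriv φ u (v i))) := rfl

theorem chartForm_chartDeriv (hφ : φ ∈ IsManifold.maximalAtlas (𝓡 n) ∞ M)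
    (α : LeafForm F k) {u : Model n} (hu : u ∈ φ.target)
    (v : Fin k → TangentSpace (𝓡 n) (φ.symm u)) :
    chartForm α φ u (fun i => chartDeriv φ (φ.symm u) (v i)) =
      α (φ.symm u) (fun i => (F.tangent (φ.symm u)).orthogonalProjectionOnto (v i)) := by
  simp only [chartForm_apply, chartInvDeriv_chartDeriv hφ hu]

theorem chartForm_transition (hφ : φ ∈ IsManifold.maximalAtlas (𝓡 n) ∞ M)
    (hψ : ψ ∈ IsManifold.maximalAtlas (𝓡 n) ∞ M) (α : LeafForm F k) {u : Model n}
    (hu : u ∈ φ.target ∩ φ.symm ⁻¹' ψ.source) :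
    chartForm α φ u = (chartForm α ψ ((ψ ∘ φ.symm) u)).compContinuousLinearMap
      (fderiv ℝ (ψ ∘ φ.symm) u) := by
  ext v
  have hchart (x : M) (hx : x ∈ ψ.source) (w : Fin k → TangentSpace (𝓡 n) x) :
      chartForm α ψ (ψ x) (fun i => chartDeriv ψ x (w i)) =
        α x (fun i => (F.tangent x).orthogonalProjectionOnto (w i)) := by
    obtain ⟨y, hy, rfl⟩ : ∃ y ∈ ψ.target, ψ.symm y = x := ⟨ψ x, ψ.map_source hx, ψ.left_inv hx⟩
    rw [ψ.right_inv hy]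
    exact chartForm_chartDeriv hψ α hy w
  rw [chartForm_apply, ← hchart _ hu.2]
  exact congrArg _ (funext fun i => (fderiv_transition_apply hφ hψ hu (v i)).symm)

theorem contDiffOn_chartForm_transition (hφ : φ ∈ IsManifold.maximalAtlas (𝓡 n) ∞ M)
    (hψ : ψ ∈ IsManifold.maximalAtlas (𝓡 n) ∞ M) {α : LeafForm F k}
    (hα : ContDiffOn ℝ ∞ (chartForm α ψ) ψ.target) :
    ContDiffOn ℝ ∞ (chartForm α φ) (φ.target ∩ φ.symm ⁻¹' ψ.source) := by
  have htransition := contDiffOn_transition hφ hψ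
  refine ContDiffOn.congr (contDiffOn_of_forall_apply fun v => ?_)
    fun u hu => chartForm_transition hφ hψ α hu
  refine contDiffOn_apply (f := fun u => chartForm α ψ ((ψ ∘ φ.symm) u))
    (v := fun i u => fderiv ℝ (ψ ∘ φ.symm) u (v i))
    (hα.comp htransition fun u hu => ψ.map_source hu.2) fun i => ?_
  exact (htransition.fderiv_of_isOpen (isOpen_transition φ ψ) (m := ∞) (by simp)).clm_apply
    contDiffOn_const

variable [IsManifold (𝓡 n) ∞ M]

theorem IsSmooth.contDiffOn_chartForm {α : LeafForm F k} (hα : IsSmooth α)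
    (hφ : φ ∈ IsManifold.maximalAtlas (𝓡 n) ∞ M) : ContDiffOn ℝ ∞ (chartForm α φ) φ.target := by
  refine contDiffOn_of_locally_contDiffOn fun u hu =>
    ⟨φ.target ∩ φ.symm ⁻¹' (chartAt (Model n) (φ.symm u)).source, isOpen_transition _ _,
      ⟨hu, mem_chart_source _ _⟩, ?_⟩
  exact (contDiffOn_chartForm_transition hφ (IsManifold.chart_mem_maximalAtlas (φ.symm u))
    (hα _ (chart_mem_atlas _ _))).mono Set.inter_subset_right

theorem isSmooth_of_forall_exists {α : LeafForm F k}
    (h : ∀ x : M, ∃ φ ∈ IsManifold.maximalAtlas (𝓡 n) ∞ M, x ∈ φ.source ∧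
      ContDiffOn ℝ ∞ (chartForm α φ) φ.target) : IsSmooth α := by
  refine fun φ hφ => contDiffOn_of_locally_contDiffOn fun u hu => ?_
  obtain ⟨ψ, hψ, hx, hψα⟩ := h (φ.symm u)
  exact ⟨φ.target ∩ φ.symm ⁻¹' ψ.source, isOpen_transition _ _, ⟨hu, hx⟩,
    (contDiffOn_chartForm_transition (IsManifold.subset_maximalAtlas hφ) hψ hψα).mono
      Set.inter_subset_right⟩

theorem leafD_apply_symm {α : LeafForm F k} (hα : IsSmooth α)
    (hφ : φ ∈ IsManifold.maximalAtlas (𝓡 n) ∞ M) {u : Model n} (hu : u ∈ φ.target)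
    (v : Fin (k + 1) → F.tangent (φ.symm u)) :
    leafD α (φ.symm u) v =
      extDeriv (chartForm α φ) u (fun i => chartDeriv φ (φ.symm u) (v i)) := by
  generalize hx : φ.symm u = x at v
  have hxφ : x ∈ φ.source := hx ▸ φ.map_target hu
  obtain rfl : φ x = u := by rw [← hx, φ.right_inv hu]
  set ψ := chartAt (Model n) x 
  have hψ : ψ ∈ IsManifold.maximalAtlas (𝓡 n) ∞ M := IsManifold.chart_mem_maximalAtlas x
  have hxψ : ψ.symm (ψ x) = x := ψ.left_inv (mem_chart_source _ x)
  have hψx : ψ x ∈ ψ.target ∩ ψ.symm ⁻¹' φ.source :=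
    ⟨ψ.map_source (mem_chart_source _ x), by rwa [Set.mem_preimage, hxψ]⟩
  have hmem := (isOpen_transition ψ φ).mem_nhds hψx
  have hφx : (φ ∘ ψ.symm) (ψ x) = φ x := congrArg φ hxψ
  have hpullback : chartForm α ψ =ᶠ[nhds (ψ x)] fun u => (chartForm α φ
      ((φ ∘ ψ.symm) u)).compContinuousLinearMap (fderiv ℝ (φ ∘ ψ.symm) u) :=
    Filter.mem_of_superset hmem fun u hu => chartForm_transition hψ hφ α hu
  have hdiff : DifferentiableAt ℝ (chartForm α φ) ((φ ∘ ψ.symm) (ψ x)) := by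
    rw [hφx]
    exact ((hα.contDiffOn_chartForm hφ).contDiffAt
      (φ.open_target.mem_nhds (φ.map_source hxφ))).differentiableAt (by simp)
  change extDeriv (chartForm α ψ) (ψ x) (fun i => chartDeriv ψ x (v i)) = _
  rw [hpullback.extDeriv_eq, extDeriv_pullback hdiff
    ((contDiffOn_transition hψ hφ).contDiffAt hmem) (by
      rw [minSmoothness_of_isRCLikeNormedField]
      exact WithTop.coe_le_coe.2 le_top), hφx]
  have hchange := fderiv_transition_chartDeriv hψ hφ hψx
  rw [hxψ] at hchange
  exact congrArg (extDeriv (chartForm α φ) (φ x)) (funext fun i => hchange (v i))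

end LeafForms

section LeafVec

variable {n p : ℕ}

/-- The `i`-th coordinate vector of `ℝᵖ × {0}`, as a vector of `ℝⁿ`; it is meant for `p ≤ n`. -/
def leafVec (n : ℕ) (i : Fin p) : Model n :=
  WithLp.toLp 2 fun j => if (j : ℕ) = i then 1 else 0

theorem leafVec_mem (i : Fin p) : leafVec n i ∈ leafModel n p :=
  fun j hj => if_neg (by omega)

theorem leafVec_eq_basisFun (hpn : p ≤ n) (i : Fin p) :
    leafVec n i = EuclideanSpace.basisFun (Fin n) ℝ (Fin.castLE hpn i) := by
  ext j
  simp [leafVec, Fin.ext_iff]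

theorem linearIndependent_leafVec (hpn : p ≤ n) :
    LinearIndependent ℝ (leafVec n : Fin p → Model n) := by
  rw [funext (leafVec_eq_basisFun hpn)]
  exact (EuclideanSpace.basisFun (Fin n) ℝ).orthonormal.linearIndependent.comp _
    (Fin.castLE_injective hpn)

end LeafVec

section Frames

variable {n p k l m : ℕ} {M : Type*} [TopologicalSpace M] [ChartedSpace (Model n) M]
  {φ : OpenPartialHomeomorph M (Model n)} {F : Foliation n M p}

theorem Foliation.le (F : Foliation n M p) (x : M) : p ≤ n := by
  calc p = Module.finrank ℝ (F.tangent x) := (F.finrank_tangent x).symm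
    _ ≤ Module.finrank ℝ (TangentSpace (𝓡 n) x) := Submodule.finrank_le _
    _ = n := finrank_euclideanSpace_fin (𝕜 := ℝ)

theorem IsFlatChart.chartInvDeriv_mem (hφ : IsFlatChart p F.tangent φ) {u : Model n}
    (hu : u ∈ φ.target) {v : Model n} (hv : v ∈ leafModel n p) :
    chartInvDeriv φ u v ∈ F.tangent (φ.symm u) := by
  rw [← chartDeriv_chartInvDeriv hφ.1 hu v] at hv
  exact (hφ.2 _ (φ.map_target hu) _).2 hv

variable [RiemannianBundle (fun x : M => TangentSpace (𝓡 n) x)]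

/-- The coordinate fields of the chart `φ` along the leaves. In a flat chart the orthogonal
projection in this definition is the identity; it serves to land in the leafwise tangent space. -/
def coordField (F : Foliation n M p) (φ : OpenPartialHomeomorph M (Model n)) (u : Model n)
    (i : Fin p) : F.tangent (φ.symm u) :=
  (F.tangent (φ.symm u)).orthogonalProjectionOnto (chartInvDeriv φ u (leafVec n i))

theorem coe_coordField (hφ : IsFlatChart p F.tangent φ) {u : Model n} (hu : u ∈ φ.target)
    (i : Fin p) : (coordField F φ u i : TangentSpace (𝓡 n) (φ.symm u)) =
      chartInvDeriv φ u (leafVec n i) :=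
  Submodule.starProjection_eq_self_iff.2 (hφ.chartInvDeriv_mem hu (leafVec_mem i))

theorem chartDeriv_coordField (hφ : IsFlatChart p F.tangent φ) {u : Model n} (hu : u ∈ φ.target)
    (i : Fin p) : chartDeriv φ (φ.symm u) (coordField F φ u i) = leafVec n i := by
  rw [coe_coordField hφ hu, chartDeriv_chartInvDeriv hφ.1 hu]

theorem linearIndependent_coordField (hφ : IsFlatChart p F.tangent φ) {u : Model n}
    (hu : u ∈ φ.target) : LinearIndependent ℝ (coordField F φ u) := by
  refine LinearIndependent.of_comp
    ((chartDeriv φ (φ.symm u)).toLinearMap ∘ₗ (F.tangent (φ.symm u)).subtype) ?_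
  convert linearIndependent_leafVec (n := n) (F.le (φ.symm u)) using 1
  exact funext fun i => chartDeriv_coordField hφ hu i

/-- The Gram–Schmidt orthonormalization of the leafwise coordinate fields: an orthonormal frame of
the leafwise tangent bundle over the domain of a flat chart. -/
def leafFrame (F : Foliation n M p) (φ : OpenPartialHomeomorph M (Model n)) (u : Model n) :
    OrthonormalBasis (Fin p) ℝ (F.tangent (φ.symm u)) :=
  InnerProductSpace.gramSchmidtOrthonormalBasis
    (by rw [F.finrank_tangent, Fintype.card_fin]) (coordField F φ u)

/-- The orthonormal frame `leafFrame`, read in the chart `φ`. -/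
def frameVec (F : Foliation n M p) (φ : OpenPartialHomeomorph M (Model n)) (i : Fin p)
    (u : Model n) : Model n :=
  chartDeriv φ (φ.symm u) (leafFrame F φ u i)

/-- The (not normalized) Gram–Schmidt orthogonalization of the leafwise coordinate fields, read in
the chart `φ`. -/
def chartGramSchmidt (F : Foliation n M p) (φ : OpenPartialHomeomorph M (Model n)) (i : Fin p)
    (u : Model n) : Model n :=
  chartDeriv φ (φ.symm u)
    (InnerProductSpace.gramSchmidt ℝ (coordField F φ u) i : F.tangent (φ.symm u))

theorem chartMetric_chartGramSchmidt_self (hφ : IsFlatChart p F.tangent φ) (i : Fin p)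
    {u : Model n} (hu : u ∈ φ.target) :
    chartMetric φ u (chartGramSchmidt F φ i u) (chartGramSchmidt F φ i u) =
      ‖InnerProductSpace.gramSchmidt ℝ (coordField F φ u) i‖ ^ 2 := by
  rw [chartGramSchmidt, chartMetric_chartDeriv hφ.1 hu, ← Submodule.coe_inner,
    real_inner_self_eq_norm_sq]

theorem norm_gramSchmidt_coordField_ne_zero (hφ : IsFlatChart p F.tangent φ) (i : Fin p)
    {u : Model n} (hu : u ∈ φ.target) :
    ‖InnerProductSpace.gramSchmidt ℝ (coordField F φ u) i‖ ≠ 0 :=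
  norm_ne_zero_iff.2
    (InnerProductSpace.gramSchmidt_ne_zero i (linearIndependent_coordField hφ hu))

theorem chartGramSchmidt_eq_sub (hφ : IsFlatChart p F.tangent φ) (i : Fin p) {u : Model n}
    (hu : u ∈ φ.target) : chartGramSchmidt F φ i u = leafVec n i - ∑ j ∈ Finset.Iio i,
      (chartMetric φ u (chartGramSchmidt F φ j u) (leafVec n i) /
        chartMetric φ u (chartGramSchmidt F φ j u) (chartGramSchmidt F φ j u)) •
          chartGramSchmidt F φ j u := by
  have hrec := congrArg (fun w : F.tangent (φ.symm u) =>
    chartDeriv φ (φ.symm u) (w : TangentSpace (𝓡 n) (φ.symm u)))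
      (InnerProductSpace.gramSchmidt_def'' ℝ (coordField F φ u) i)
  simp only [Submodule.coe_add, map_add, Submodule.coe_sum, map_sum, Submodule.coe_smul,
    map_smul, chartDeriv_coordField hφ hu] at hrec
  refine eq_sub_of_add_eq (Eq.trans (congrArg _ (Finset.sum_congr rfl fun j _ => ?_)) hrec.symm)
  rw [chartMetric_chartGramSchmidt_self hφ j hu, chartGramSchmidt, ← chartDeriv_coordField hφ hu,
    chartMetric_chartDeriv hφ.1 hu, ← Submodule.coe_inner]
  rfl

theorem frameVec_eq_smul_chartGramSchmidt (hφ : IsFlatChart p F.tangent φ) (i : Fin p)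
    {u : Model n} (hu : u ∈ φ.target) : frameVec F φ i u =
      (√(chartMetric φ u (chartGramSchmidt F φ i u) (chartGramSchmidt F φ i u)))⁻¹ •
        chartGramSchmidt F φ i u := by
  have hne : InnerProductSpace.gramSchmidtNormed ℝ (coordField F φ u) i ≠ 0 := by
    rw [← norm_ne_zero_iff, InnerProductSpace.gramSchmidtNormed_unit_length i
      (linearIndependent_coordField hφ hu)]
    exact one_ne_zero
  rw [chartMetric_chartGramSchmidt_self hφ i hu, Real.sqrt_sq (norm_nonneg _), frameVec,
    leafFrame, InnerProductSpace.gramSchmidtOrthonormalBasis_apply _ hne,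
    InnerProductSpace.gramSchmidtNormed, Submodule.coe_smul, map_smul]
  rfl

theorem chartForm_frameVec (hφ : IsFlatChart p F.tangent φ) (α : LeafForm F k) {u : Model n}
    (hu : u ∈ φ.target) (I : Fin k → Fin p) :
    chartForm α φ u (fun i => frameVec F φ (I i) u) =
      α (φ.symm u) (fun i => leafFrame F φ u (I i)) := by
  refine (chartForm_chartDeriv hφ.1 α hu _).trans ?_
  simp only [Submodule.orthogonalProjectionOnto_mem_subspace_eq_self]

theorem chartForm_eq_sum (hφ : IsFlatChart p F.tangent φ) (α : LeafForm F k) {u : Model n}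
    (hu : u ∈ φ.target) (v : Fin k → Model n) :
    chartForm α φ u v = ∑ I : Fin k → Fin p, (∏ i, chartMetric φ u (frameVec F φ (I i) u)
      (v i)) * α (φ.symm u) (fun i => leafFrame F φ u (I i)) := by
  rw [chartForm_apply, alternatingMap_apply_eq_sum_inner (leafFrame F φ u)]
  refine Finset.sum_congr rfl fun I _ => congrArg (· * _) (Finset.prod_congr rfl fun i _ => ?_)
  rw [frameVec, chartMetric, chartInvDeriv_chartDeriv hφ.1 hu]
  exact Submodule.inner_orthogonalProjectionOnto_eq_of_mem_left _ _

variable [IsManifold (𝓡 n) ∞ M]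
  [IsContMDiffRiemannianBundle (𝓡 n) ∞ (Model n) (fun x : M => TangentSpace (𝓡 n) x)]

theorem contDiffOn_chartGramSchmidt (hφ : IsFlatChart p F.tangent φ) (i : Fin p) :
    ContDiffOn ℝ ∞ (chartGramSchmidt F φ i) φ.target := by
  induction i using WellFoundedLT.induction with
  | ind i ih =>
    refine (contDiffOn_const.sub (ContDiffOn.sum fun j hj => ?_)).congr
      fun u hu => chartGramSchmidt_eq_sub hφ i hu
    have hj := ih j (Finset.mem_Iio.1 hj)
    refine ((contDiffOn_chartMetric hφ.1 hj contDiffOn_const).div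
      (contDiffOn_chartMetric hφ.1 hj hj) fun u hu => ?_).smul hj
    rw [chartMetric_chartGramSchmidt_self hφ j hu]
    exact pow_ne_zero 2 (norm_gramSchmidt_coordField_ne_zero hφ j hu)

theorem contDiffOn_frameVec (hφ : IsFlatChart p F.tangent φ) (i : Fin p) :
    ContDiffOn ℝ ∞ (frameVec F φ i) φ.target := by
  have hsmooth := contDiffOn_chartGramSchmidt hφ i
  have hne {u : Model n} (hu : u ∈ φ.target) := norm_gramSchmidt_coordField_ne_zero hφ i hu
  refine ((((contDiffOn_chartMetric hφ.1 hsmooth hsmooth).sqrt fun u hu => ?_).inv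
    fun u hu => ?_).smul hsmooth).congr fun u hu => frameVec_eq_smul_chartGramSchmidt hφ i hu
  · rw [chartMetric_chartGramSchmidt_self hφ i hu]
    exact pow_ne_zero 2 (hne hu)
  · rw [chartMetric_chartGramSchmidt_self hφ i hu, Real.sqrt_sq (norm_nonneg _)]
    exact hne hu

theorem IsSmooth.contDiffOn_frame {α : LeafForm F k} (hα : IsSmooth α)
    (hφ : IsFlatChart p F.tangent φ) (I : Fin k → Fin p) :
    ContDiffOn ℝ ∞ (fun u => α (φ.symm u) (fun i => leafFrame F φ u (I i))) φ.target :=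
  (contDiffOn_apply (hα.contDiffOn_chartForm hφ.1)
    fun i => contDiffOn_frameVec hφ (I i)).congr fun _ hu => (chartForm_frameVec hφ α hu I).symm

theorem isSmooth_of_frame {α : LeafForm F k}
    (h : ∀ φ : OpenPartialHomeomorph M (Model n), IsFlatChart p F.tangent φ →
      ∀ I : Fin k → Fin p,
        ContDiffOn ℝ ∞ (fun u => α (φ.symm u) (fun i => leafFrame F φ u (I i))) φ.target) :
    IsSmooth α := by
  refine isSmooth_of_forall_exists fun x => ?_
  obtain ⟨φ, hx, hφ⟩ := F.exists_flatChart x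
  refine ⟨φ, hφ.1, hx, contDiffOn_of_forall_apply fun v => ?_⟩
  refine ContDiffOn.congr ?_ fun u hu => chartForm_eq_sum hφ α hu v
  exact ContDiffOn.sum fun I _ => (contDiffOn_prod fun i _ =>
    contDiffOn_chartMetric hφ.1 (contDiffOn_frameVec hφ _) contDiffOn_const).mul (h φ hφ I)

theorem isSmooth_zero : IsSmooth (0 : LeafForm F k) :=
  isSmooth_of_frame fun _ _ _ => contDiffOn_const

theorem IsSmooth.add {α β : LeafForm F k} (hα : IsSmooth α) (hβ : IsSmooth β) :
    IsSmooth (α + β) :=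
  isSmooth_of_frame fun _ hφ I => (hα.contDiffOn_frame hφ I).add (hβ.contDiffOn_frame hφ I)

theorem IsSmooth.sub {α β : LeafForm F k} (hα : IsSmooth α) (hβ : IsSmooth β) :
    IsSmooth (α - β) :=
  isSmooth_of_frame fun _ hφ I => (hα.contDiffOn_frame hφ I).sub (hβ.contDiffOn_frame hφ I)

theorem IsSmooth.neg {α : LeafForm F k} (hα : IsSmooth α) : IsSmooth (-α) :=
  isSmooth_of_frame fun _ hφ I => (hα.contDiffOn_frame hφ I).neg

theorem IsSmooth.const_smul {α : LeafForm F k} (hα : IsSmooth α) (c : ℝ) : IsSmooth (c • α) :=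
  isSmooth_of_frame fun _ hφ I => contDiffOn_const.mul (hα.contDiffOn_frame hφ I)

theorem IsSmooth.smul {α : LeafForm F k} (hα : IsSmooth α) {f : M → ℝ}
    (hf : ContMDiff (𝓡 n) 𝓘(ℝ, ℝ) ∞ f) : IsSmooth (fun x => f x • α x : LeafForm F k) :=
  isSmooth_of_frame fun _ hφ I => (contDiffOn_comp_symm hφ.1 hf).mul (hα.contDiffOn_frame hφ I)

theorem IsSmooth.wedge (h : k + l = m) {α : LeafForm F k} {β : LeafForm F l} (hα : IsSmooth α)
    (hβ : IsSmooth β) : IsSmooth (wedge h α β) := by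
  refine isSmooth_of_frame fun φ hφ I => ?_
  simp only [Leafwise.wedge, wedgeAlt_apply, antisymSum]
  exact contDiffOn_const.mul (ContDiffOn.sum fun s _ => contDiffOn_const.mul
    ((hα.contDiffOn_frame hφ _).mul (hβ.contDiffOn_frame hφ _)))

theorem IsSmooth.leafD {α : LeafForm F k} (hα : IsSmooth α) : IsSmooth (leafD α) :=
  isSmooth_of_frame fun φ hφ I =>
    (contDiffOn_apply (contDiffOn_extDeriv φ.open_target (hα.contDiffOn_chartForm hφ.1))
      fun i => contDiffOn_frameVec hφ (I i)).congr fun _ hu => leafD_apply_symm hα hφ.1 hu _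

theorem IsSmooth.twistedD {η : LeafForm F 1} (hη : IsSmooth η) {α : LeafForm F k}
    (hα : IsSmooth α) : IsSmooth (twistedD η α) :=
  hα.leafD.add (hη.wedge _ hα)

theorem IsSmooth.contDiffOn_innerAlt {α β : LeafForm F k} (hα : IsSmooth α) (hβ : IsSmooth β)
    (hφ : IsFlatChart p F.tangent φ) :
    ContDiffOn ℝ ∞ (fun u => innerAlt (α (φ.symm u)) (β (φ.symm u))) φ.target := by
  simp only [fun u => innerAlt_eq_sum (leafFrame F φ u) (α (φ.symm u)) (β (φ.symm u))]
  exact contDiffOn_const.mul (ContDiffOn.sum fun I _ =>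
    (hα.contDiffOn_frame hφ I).mul (hβ.contDiffOn_frame hφ I))

theorem IsSmooth.continuous_innerAlt {α β : LeafForm F k} (hα : IsSmooth α) (hβ : IsSmooth β) :
    Continuous (fun x => innerAlt (α x) (β x)) := by
  refine continuous_iff_continuousAt.2 fun x => ?_
  obtain ⟨φ, hx, hφ⟩ := F.exists_flatChart x
  refine (((hα.contDiffOn_innerAlt hβ hφ).continuousOn.comp φ.continuousOn fun y hy =>
    φ.map_source hy).congr fun y hy => ?_).continuousAt (φ.open_source.mem_nhds hx)
  exact congrArg (fun z => innerAlt (α z) (β z)) (φ.left_inv hy).symm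

end Frames

section Orientation

variable {p : ℕ} {V : Type*} [NormedAddCommGroup V] [InnerProductSpace ℝ V]
  [Fact (Module.finrank ℝ V = p)]

theorem apply_orthonormalBasis_ne_zero (e : OrthonormalBasis (Fin p) ℝ V)
    {θ : V [⋀^Fin p]→ₗ[ℝ] ℝ} (hθ : θ ≠ 0) : θ e ≠ 0 := by
  intro hθe
  rw [eq_smul_volumeForm (rayOfNeZero ℝ θ hθ : Orientation ℝ V (Fin p)) e θ, hθe, zero_mul,
    zero_smul] at hθ
  exact hθ rfl

variable [FiniteDimensional ℝ V] (o : Orientation ℝ V (Fin p))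

theorem rayOfNeZero_volumeForm : rayOfNeZero ℝ o.volumeForm (volumeForm_ne_zero o) = o := by
  let e := (stdOrthonormalBasis ℝ V).reindex (finCongr (Fact.out : Module.finrank ℝ V = p))
  by_cases he : e.toBasis.orientation = o
  · simp only [o.volumeForm_robust e he]
    exact he
  · simp only [o.volumeForm_robust_neg e he]
    rw [← neg_rayOfNeZero]
    exact ((e.toBasis.orientation_eq_or_eq_neg o).resolve_left (Ne.symm he)).symm

theorem volumeForm_eq_smul_of_eq_rayOfNeZero (e : OrthonormalBasis (Fin p) ℝ V)
    {θ : V [⋀^Fin p]→ₗ[ℝ] ℝ} (hθ : θ ≠ 0)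
    (ho : o = rayOfNeZero ℝ θ hθ) : o.volumeForm = |θ e|⁻¹ • θ := by
  have hθe := apply_orthonormalBasis_ne_zero e hθ
  have hpos : 0 < θ e * o.volumeForm e := by
    have hray : SameRay ℝ o.volumeForm ((θ e * o.volumeForm e) • o.volumeForm) := by
      rw [← eq_smul_volumeForm o e θ]
      exact (ray_eq_iff (volumeForm_ne_zero o) hθ).1 ((rayOfNeZero_volumeForm o).trans ho)
    exact (sameRay_smul_right_iff_of_ne (volumeForm_ne_zero o)
      (mul_ne_zero hθe fun h0 => by simpa [h0] using volumeForm_apply_mul_self o e)).1 hray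
  have habs : |θ e| = θ e * o.volumeForm e := by
    rw [← abs_of_pos hpos, abs_mul, o.abs_volumeForm_apply_of_orthonormal e, mul_one]
  rw [habs, eq_inv_smul_iff₀ hpos.ne']
  exact (eq_smul_volumeForm o e θ).symm

end Orientation

section Star

variable {n p k l : ℕ} {M : Type*} [TopologicalSpace M] [ChartedSpace (Model n) M]
  [RiemannianBundle (fun x : M => TangentSpace (𝓡 n) x)] {F : Foliation n M p}

/-- The leafwise volume form `χ_𝓕`. -/
def volForm (o : ∀ x : M, Orientation ℝ (F.tangent x) (Fin p)) : LeafForm F p :=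
  fun x => (o x).volumeForm

variable [IsManifold (𝓡 n) ∞ M]
  [IsContMDiffRiemannianBundle (𝓡 n) ∞ (Model n) (fun x : M => TangentSpace (𝓡 n) x)]
  (o : ∀ x : M, Orientation ℝ (F.tangent x) (Fin p))

theorem isSmooth_volForm (ho : IsLeafOrientation o) : IsSmooth (volForm o) := by
  obtain ⟨θ, hθ, hoθ⟩ := ho
  refine isSmooth_of_frame fun φ hφ I => ?_
  have hcoeff := hθ.contDiffOn_frame hφ id
  have hne (u : Model n) : θ (φ.symm u) (leafFrame F φ u) ≠ 0 :=
    apply_orthonormalBasis_ne_zero _ (hoθ (φ.symm u)).1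
  have hinv : ContDiffOn ℝ ∞ (fun u => |θ (φ.symm u) (leafFrame F φ u)|⁻¹) φ.target :=
    ContDiffOn.inv (fun u hu => (contDiffAt_abs (hne u)).comp_contDiffWithinAt
      (g := fun t : ℝ => |t|) u (hcoeff u hu)) fun u _ => abs_ne_zero.2 (hne u)
  refine (hinv.mul (hθ.contDiffOn_frame hφ I)).congr fun u _ => ?_
  obtain ⟨h0, hray⟩ := hoθ (φ.symm u)
  rw [volForm, volumeForm_eq_smul_of_eq_rayOfNeZero _ (leafFrame F φ u) h0 hray]
  rfl

theorem IsSmooth.hodgeStar (ho : IsLeafOrientation o) (h : k + l = p) {β : LeafForm F k}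
    (hβ : IsSmooth β) : IsSmooth (hodgeStar o h β) := by
  refine isSmooth_of_frame fun φ hφ J => ?_
  have hstar (u : Model n) := (congrArg (fun c => c (leafFrame F φ u ∘ J))
    (starAlt_eq_basisStar (o (φ.symm u)) (leafFrame F φ u) h (β (φ.symm u)))).trans
      (basisStar_apply ..)
  refine ContDiffOn.congr ?_ fun u _ => hstar u
  refine contDiffOn_const.mul (ContDiffOn.sum fun I _ => (hβ.contDiffOn_frame hφ I).mul ?_)
  refine ((isSmooth_volForm o ho).contDiffOn_frame hφ
    (Sum.elim I J ∘ (blockEquiv h).symm)).congr fun u _ => ?_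
  rw [contractLeft_apply, ← Sum.comp_elim]
  rfl

end Star

section Volume

theorem measurableSet_target_inter {X Y : Type*} [TopologicalSpace X] [MeasurableSpace X]
    [BorelSpace X] [TopologicalSpace Y] [MeasurableSpace Y] [OpensMeasurableSpace Y]
    (φ : OpenPartialHomeomorph X Y) {s : Set X} (hs : MeasurableSet s) :
    MeasurableSet (φ.target ∩ φ.symm ⁻¹' s) := by
  have hmeas : Measurable (φ.target.domRestrict φ.symm) :=
    (continuousOn_iff_continuous_domRestrict.1 φ.continuousOn_symm).measurable
  rw [← Subtype.image_preimage_coe]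
  exact φ.open_target.measurableSet.subtype_image (hmeas hs)

variable {n : ℕ} {M : Type*} [TopologicalSpace M] [ChartedSpace (Model n) M]
  {φ ψ : OpenPartialHomeomorph M (Model n)}
  [RiemannianBundle (fun x : M => TangentSpace (𝓡 n) x)]

/-- The matrix `(g_{ij})` of the Riemannian metric in the chart `φ`. -/
def gramMatrix (φ : OpenPartialHomeomorph M (Model n)) (u : Model n) : Matrix (Fin n) (Fin n) ℝ :=
  Matrix.of fun i j => chartMetric φ u (EuclideanSpace.basisFun (Fin n) ℝ i)
    (EuclideanSpace.basisFun (Fin n) ℝ j)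

theorem volDensity_eq_sqrt_det (φ : OpenPartialHomeomorph M (Model n)) (u : Model n) :
    volDensity φ u = √(gramMatrix φ u).det := rfl

theorem det_gramMatrix_pos (hφ : φ ∈ IsManifold.maximalAtlas (𝓡 n) ∞ M) {u : Model n}
    (hu : u ∈ φ.target) : 0 < (gramMatrix φ u).det := by
  have hindep : LinearIndependent ℝ
      (fun i => chartInvDeriv φ u (EuclideanSpace.basisFun (Fin n) ℝ i)) :=
    (EuclideanSpace.basisFun (Fin n) ℝ).orthonormal.linearIndependent.map'
      (chartInvDeriv φ u).toLinearMap
      (LinearMap.ker_eq_bot.2 (Function.LeftInverse.injective (chartDeriv_chartInvDeriv hφ hu)))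
  exact ((Matrix.posDef_gram_iff_linearIndependent (𝕜 := ℝ)).2 hindep).det_pos

theorem volDensity_pos (hφ : φ ∈ IsManifold.maximalAtlas (𝓡 n) ∞ M) {u : Model n}
    (hu : u ∈ φ.target) : 0 < volDensity φ u :=
  Real.sqrt_pos.2 (det_gramMatrix_pos hφ hu)

theorem chartMetric_transition (hφ : φ ∈ IsManifold.maximalAtlas (𝓡 n) ∞ M)
    (hψ : ψ ∈ IsManifold.maximalAtlas (𝓡 n) ∞ M) {u : Model n}
    (hu : u ∈ φ.target ∩ φ.symm ⁻¹' ψ.source) (v w : Model n) :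
    chartMetric φ u v w = chartMetric ψ ((ψ ∘ φ.symm) u) (fderiv ℝ (ψ ∘ φ.symm) u v)
      (fderiv ℝ (ψ ∘ φ.symm) u w) := by
  have hmetric : ∀ x ∈ ψ.source, ∀ v w : TangentSpace (𝓡 n) x,
      chartMetric ψ (ψ x) (chartDeriv ψ x v) (chartDeriv ψ x w) = inner ℝ v w := by
    intro x hx
    obtain ⟨y, hy, rfl⟩ : ∃ y ∈ ψ.target, ψ.symm y = x := ⟨ψ x, ψ.map_source hx, ψ.left_inv hx⟩
    intro v w
    rw [ψ.right_inv hy, chartMetric_chartDeriv hψ hy]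
  rw [fderiv_transition_apply hφ hψ hu, fderiv_transition_apply hφ hψ hu]
  exact (hmetric _ hu.2 _ _).symm

theorem gramMatrix_transition (hφ : φ ∈ IsManifold.maximalAtlas (𝓡 n) ∞ M)
    (hψ : ψ ∈ IsManifold.maximalAtlas (𝓡 n) ∞ M) {u : Model n}
    (hu : u ∈ φ.target ∩ φ.symm ⁻¹' ψ.source) {J : Matrix (Fin n) (Fin n) ℝ}
    (hJ : J = (fderiv ℝ (ψ ∘ φ.symm) u).toLinearMap.toMatrix
      (EuclideanSpace.basisFun (Fin n) ℝ).toBasis (EuclideanSpace.basisFun (Fin n) ℝ).toBasis) :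
    gramMatrix φ u = J.transpose * gramMatrix ψ ((ψ ∘ φ.symm) u) * J := by
  have hentry (i j : Fin n) :
      fderiv ℝ (ψ ∘ φ.symm) u (EuclideanSpace.basisFun (Fin n) ℝ i) j = J j i := by
    simp [hJ, LinearMap.toMatrix_apply]
  ext i j
  rw [gramMatrix, Matrix.of_apply, chartMetric_transition hφ hψ hu, chartMetric_eq_sum]
  simp only [hentry, Matrix.mul_apply, Matrix.transpose_apply, Finset.sum_mul]
  rw [Finset.sum_comm]
  refine Finset.sum_congr rfl fun a _ => Finset.sum_congr rfl fun c _ => ?_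
  simp only [gramMatrix, Matrix.of_apply]
  ring

theorem volDensity_transition (hφ : φ ∈ IsManifold.maximalAtlas (𝓡 n) ∞ M)
    (hψ : ψ ∈ IsManifold.maximalAtlas (𝓡 n) ∞ M) {u : Model n}
    (hu : u ∈ φ.target ∩ φ.symm ⁻¹' ψ.source) :
    volDensity φ u = |(fderiv ℝ (ψ ∘ φ.symm) u).det| * volDensity ψ ((ψ ∘ φ.symm) u) := by
  rw [volDensity_eq_sqrt_det, volDensity_eq_sqrt_det, gramMatrix_transition hφ hψ hu rfl,
    Matrix.det_mul, Matrix.det_mul, Matrix.det_transpose, mul_right_comm, ← sq,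
    LinearMap.det_toMatrix, Real.sqrt_mul (sq_nonneg _), Real.sqrt_sq_eq_abs]

section Measurability

variable [MeasurableSpace M] [BorelSpace M]

theorem aemeasurable_symm_withDensity (φ : OpenPartialHomeomorph M (Model n)) :
    AEMeasurable φ.symm (((volume : Measure (Model n)).restrict φ.target).withDensity
      fun u => ENNReal.ofReal (volDensity φ u)) :=
  (φ.continuousOn_symm.aemeasurable φ.open_target.measurableSet).mono_ac
    (withDensity_absolutelyContinuous _ _)

theorem chartVolume_apply (φ : OpenPartialHomeomorph M (Model n)) {s : Set M}
    (hs : MeasurableSet s) :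
    chartVolume φ s = ∫⁻ u in φ.target ∩ φ.symm ⁻¹' s, ENNReal.ofReal (volDensity φ u) := by
  rw [chartVolume, Measure.map_apply_of_aemeasurable (aemeasurable_symm_withDensity φ) hs,
    withDensity_apply', Measure.restrict_restrict' φ.open_target.measurableSet, Set.inter_comm]

theorem chartVolume_restrict_source (φ : OpenPartialHomeomorph M (Model n)) :
    (chartVolume φ).restrict φ.source = chartVolume φ := by
  refine Measure.restrict_eq_self_of_ae_mem
    ((ae_map_iff (aemeasurable_symm_withDensity φ) φ.open_source.measurableSet).2 ?_)
  exact (withDensity_absolutelyContinuous _ _).ae_le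
    ((ae_restrict_mem φ.open_target.measurableSet).mono fun u hu => φ.map_target hu)

theorem chartVolume_eq_of_subset (hφ : φ ∈ IsManifold.maximalAtlas (𝓡 n) ∞ M)
    (hψ : ψ ∈ IsManifold.maximalAtlas (𝓡 n) ∞ M) {s : Set M} (hs : MeasurableSet s)
    (hsφ : s ⊆ φ.source) (hsψ : s ⊆ ψ.source) : chartVolume φ s = chartVolume ψ s := by
  have hmeas := measurableSet_target_inter φ hs
  have hsub : φ.target ∩ φ.symm ⁻¹' s ⊆ φ.target ∩ φ.symm ⁻¹' ψ.source :=
    Set.inter_subset_inter_right _ (Set.preimage_mono hsψ)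
  have himage : (ψ ∘ φ.symm) '' (φ.target ∩ φ.symm ⁻¹' s) = ψ.target ∩ ψ.symm ⁻¹' s := by
    rw [← φ.image_eq_target_inter_inv_preimage hsφ, ← ψ.image_eq_target_inter_inv_preimage hsψ,
      Set.image_comp]
    exact congrArg (ψ '' ·) (φ.toPartialEquiv.symm_image_image_of_subset_source hsφ)
  have hinj : Set.InjOn (ψ ∘ φ.symm) (φ.target ∩ φ.symm ⁻¹' s) :=
    (ψ.injOn.mono hsψ).comp (φ.symm.injOn.mono Set.inter_subset_left) fun u hu => hu.2
  have hderiv : ∀ u ∈ φ.target ∩ φ.symm ⁻¹' s, HasFDerivWithinAt (ψ ∘ φ.symm)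
      (fderiv ℝ (ψ ∘ φ.symm) u) (φ.target ∩ φ.symm ⁻¹' s) u := fun u hu =>
    (((contDiffOn_transition hφ hψ).contDiffAt ((isOpen_transition φ ψ).mem_nhds (hsub hu)))
      |>.differentiableAt (by simp)).hasFDerivAt.hasFDerivWithinAt
  rw [chartVolume_apply φ hs, chartVolume_apply ψ hs, ← himage,
    lintegral_image_eq_lintegral_abs_det_fderiv_mul volume hmeas hderiv hinj]
  refine setLIntegral_congr_fun hmeas fun u hu => ?_
  rw [volDensity_transition hφ hψ (hsub hu), ENNReal.ofReal_mul (abs_nonneg _)]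

theorem chartVolume_restrict_comm (hφ : φ ∈ IsManifold.maximalAtlas (𝓡 n) ∞ M)
    (hψ : ψ ∈ IsManifold.maximalAtlas (𝓡 n) ∞ M) :
    (chartVolume φ).restrict ψ.source = (chartVolume ψ).restrict φ.source := by
  rw [← chartVolume_restrict_source φ, ← chartVolume_restrict_source ψ,
    Measure.restrict_restrict ψ.open_source.measurableSet,
    Measure.restrict_restrict φ.open_source.measurableSet, Set.inter_comm]
  ext s hs
  rw [Measure.restrict_apply hs, Measure.restrict_apply hs]
  exact chartVolume_eq_of_subset hφ hψ
    (hs.inter (φ.open_source.measurableSet.inter ψ.open_source.measurableSet))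
    (Set.inter_subset_right.trans Set.inter_subset_left)
    (Set.inter_subset_right.trans Set.inter_subset_right)

end Measurability

variable [IsManifold (𝓡 n) ∞ M]

theorem contDiffOn_volDensity
    [IsContMDiffRiemannianBundle (𝓡 n) ∞ (Model n) (fun x : M => TangentSpace (𝓡 n) x)]
    (hφ : φ ∈ IsManifold.maximalAtlas (𝓡 n) ∞ M) : ContDiffOn ℝ ∞ (volDensity φ) φ.target := by
  refine ContDiffOn.sqrt (f := fun u => (gramMatrix φ u).det) ?_
    fun u hu => (det_gramMatrix_pos hφ hu).ne'
  simp only [Matrix.det_apply]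
  exact ContDiffOn.sum fun s _ => ContDiffOn.const_smul _
    (contDiffOn_prod fun i _ => contDiffOn_chartMetric_const hφ _ _)

variable [MeasurableSpace M] [BorelSpace M]

theorem riemannianVolume_restrict_of_mem_atlas (hφ : φ ∈ atlas (Model n) M) :
    (riemannianVolume n M).restrict φ.source = chartVolume φ := by
  have hs := φ.open_source.measurableSet
  refine le_antisymm ?_ ?_
  · have hle : riemannianVolume n M ≤
        chartVolume φ + (riemannianVolume n M).restrict φ.sourceᶜ := by
      refine iSup₂_le fun ψ hψ => ?_
      have hψle : chartVolume ψ ≤ riemannianVolume n M :=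
        le_iSup₂_of_le (f := fun (ψ : OpenPartialHomeomorph M (Model n))
          (_ : ψ ∈ atlas (Model n) M) => chartVolume ψ) ψ hψ le_rfl
      rw [← Measure.restrict_add_restrict_compl (μ := chartVolume ψ) hs,
        ← chartVolume_restrict_comm (IsManifold.subset_maximalAtlas hφ)
          (IsManifold.subset_maximalAtlas hψ)]
      exact add_le_add Measure.restrict_le_self (Measure.restrict_mono le_rfl hψle)
    calc (riemannianVolume n M).restrict φ.source
        ≤ (chartVolume φ + (riemannianVolume n M).restrict φ.sourceᶜ).restrict φ.source :=
          Measure.restrict_mono le_rfl hle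
      _ = chartVolume φ := by
        rw [Measure.restrict_add, chartVolume_restrict_source, Measure.restrict_restrict hs,
          Set.inter_compl_self, Measure.restrict_empty, add_zero]
  · rw [← chartVolume_restrict_source φ]
    exact Measure.restrict_mono le_rfl (le_iSup₂_of_le
      (f := fun (ψ : OpenPartialHomeomorph M (Model n)) (_ : ψ ∈ atlas (Model n) M) =>
        chartVolume ψ) φ hφ le_rfl)

variable [CompactSpace M]

theorem riemannianVolume_restrict (hφ : φ ∈ IsManifold.maximalAtlas (𝓡 n) ∞ M) :
    (riemannianVolume n M).restrict φ.source = chartVolume φ := by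
  obtain ⟨t, -, ht⟩ := isCompact_univ.elim_nhds_subcover
    (fun x : M => (chartAt (Model n) x).source) fun x _ => chart_source_mem_nhds _ x
  have hcover : ⋃ x : t, (chartAt (Model n) x.1).source = Set.univ := by
    rw [← Set.univ_subset_iff, Set.iUnion_subtype]
    exact ht
  refine Measure.ext_of_iUnion_eq_univ hcover fun x => ?_
  have hx := (chartAt (Model n) x.1).open_source.measurableSet
  rw [Measure.restrict_restrict hx, Set.inter_comm,
    ← Measure.restrict_restrict φ.open_source.measurableSet,
    riemannianVolume_restrict_of_mem_atlas (chart_mem_atlas _ _),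
    chartVolume_restrict_comm hφ (IsManifold.chart_mem_maximalAtlas x.1)]

theorem riemannianVolume_apply_of_subset_source (hφ : φ ∈ IsManifold.maximalAtlas (𝓡 n) ∞ M)
    {s : Set M} (hs : MeasurableSet s) (hsφ : s ⊆ φ.source) : riemannianVolume n M s =
      ∫⁻ u in φ.target ∩ φ.symm ⁻¹' s, ENNReal.ofReal (volDensity φ u) := by
  rw [← chartVolume_apply φ hs, ← riemannianVolume_restrict hφ, Measure.restrict_eq_self _ hsφ]

variable [IsContMDiffRiemannianBundle (𝓡 n) ∞ (Model n) (fun x : M => TangentSpace (𝓡 n) x)]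

theorem integral_riemannianVolume
    (hφ : φ ∈ IsManifold.maximalAtlas (𝓡 n) ∞ M) {f : M → ℝ} (hf : Continuous f)
    (h0 : ∀ x ∉ φ.source, f x = 0) :
    ∫ x, f x ∂(riemannianVolume n M) = ∫ u in φ.target, volDensity φ u * f (φ.symm u) := by
  have hdensity : AEMeasurable (volDensity φ) ((volume : Measure (Model n)).restrict φ.target) :=
    (contDiffOn_volDensity hφ).continuousOn.aemeasurable φ.open_target.measurableSet
  rw [← setIntegral_eq_integral_of_forall_compl_eq_zero h0, riemannianVolume_restrict hφ,
    chartVolume, integral_map (aemeasurable_symm_withDensity φ)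
      hf.measurable.aestronglyMeasurable,
    integral_withDensity_eq_integral_toReal_smul₀ hdensity.ennreal_ofReal (by simp)]
  refine integral_congr_ae (Filter.Eventually.of_forall fun u => ?_)
  exact congrArg (· * f (φ.symm u)) (ENNReal.toReal_ofReal (Real.sqrt_nonneg _))

instance isFiniteMeasure_riemannianVolume : IsFiniteMeasure (riemannianVolume n M) := by
  suffices hloc : IsLocallyFiniteMeasure (riemannianVolume n M) from
    ⟨isCompact_univ.measure_lt_top⟩
  refine ⟨fun x => ?_⟩
  set φ := chartAt (Model n) x
  have hφ : φ ∈ IsManifold.maximalAtlas (𝓡 n) ∞ M := IsManifold.chart_mem_maximalAtlas x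
  obtain ⟨r, hr, hball⟩ := Metric.nhds_basis_closedBall.mem_iff.1
    (φ.open_target.mem_nhds (mem_chart_target _ x))
  have hopen := φ.isOpen_inter_preimage (Metric.isOpen_ball (x := φ x) (ε := r))
  refine ⟨_, hopen.mem_nhds ⟨mem_chart_source _ x, Metric.mem_ball_self hr⟩, ?_⟩
  have hint : IntegrableOn (volDensity φ) (Metric.closedBall (φ x) r) volume :=
    ((contDiffOn_volDensity hφ).continuousOn.mono hball).integrableOn_compact
      (isCompact_closedBall _ _)
  rw [riemannianVolume_apply_of_subset_source hφ hopen.measurableSet Set.inter_subset_left]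
  refine (lintegral_mono_set ?_).trans_lt hint.lintegral_lt_top
  rintro u ⟨hu, -, hur⟩
  rw [Set.mem_preimage, φ.right_inv hu] at hur
  exact Metric.ball_subset_closedBall hur

instance isOpenPosMeasure_riemannianVolume : (riemannianVolume n M).IsOpenPosMeasure := by
  refine ⟨fun U hU ⟨x, hx⟩ hzero => ?_⟩
  set φ := chartAt (Model n) x
  have hφ : φ ∈ IsManifold.maximalAtlas (𝓡 n) ∞ M := IsManifold.chart_mem_maximalAtlas x
  have hopen : IsOpen (U ∩ φ.source) := hU.inter φ.open_source
  have hne : (φ.target ∩ φ.symm ⁻¹' (U ∩ φ.source)).Nonempty :=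
    ⟨φ x, mem_chart_target _ x, by simpa [φ] using hx⟩
  have hpos : 0 < ∫⁻ u in φ.target ∩ φ.symm ⁻¹' (U ∩ φ.source),
      ENNReal.ofReal (volDensity φ u) := by
    have hO := φ.isOpen_inter_preimage_symm hopen
    have hmeas : AEMeasurable (fun u => ENNReal.ofReal (volDensity φ u))
        ((volume : Measure (Model n)).restrict (φ.target ∩ φ.symm ⁻¹' (U ∩ φ.source))) :=
      (((contDiffOn_volDensity hφ).continuousOn.mono Set.inter_subset_left).aemeasurable
        hO.measurableSet).ennreal_ofReal
    rw [pos_iff_ne_zero, Ne, lintegral_eq_zero_iff' hmeas, Filter.EventuallyEq,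
      ae_restrict_iff' hO.measurableSet]
    intro hae
    refine (hO.measure_pos volume hne).ne' (measure_mono_null ?_ hae)
    intro u hu hu0
    exact (ENNReal.ofReal_pos.2 (volDensity_pos hφ hu.1)).ne' (hu0 hu)
  rw [← riemannianVolume_apply_of_subset_source hφ hopen.measurableSet Set.inter_subset_right,
    measure_mono_null Set.inter_subset_left hzero] at hpos
  exact lt_irrefl _ hpos

theorem integrable_of_continuous {f : M → ℝ} (hf : Continuous f) :
    Integrable f (riemannianVolume n M) :=
  hf.integrable_of_hasCompactSupport (HasCompactSupport.of_compactSpace f)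

end Volume

section GramDeterminant

variable {V : Type*} [NormedAddCommGroup V] [InnerProductSpace ℝ V]

theorem volumeForm_apply_sq_eq_det_gram {p : ℕ} [Fact (Module.finrank ℝ V = p)]
    [FiniteDimensional ℝ V] (o : Orientation ℝ V (Fin p)) (v : Fin p → V) :
    o.volumeForm v ^ 2 = (Matrix.gram ℝ v).det := by
  let e := (stdOrthonormalBasis ℝ V).reindex (finCongr (Fact.out : Module.finrank ℝ V = p))
  rw [Matrix.gram_eq_conjTranspose_mul e, Matrix.det_mul, Matrix.det_conjTranspose, ← sq_abs,
    o.volumeForm_robust' e, sq_abs, Module.Basis.det_apply, star_trivial, sq]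
  rfl

theorem gram_sum_smul {ι κ : Type*} [Fintype κ] (L : Matrix ι κ ℝ) (y : κ → V) :
    Matrix.gram ℝ (fun i => ∑ j, L i j • y j) = L * Matrix.gram ℝ y * L.transpose := by
  ext i j
  simp only [Matrix.gram_apply, Matrix.mul_apply, Matrix.transpose_apply, sum_inner, inner_sum,
    real_inner_smul_left, real_inner_smul_right, Finset.sum_mul]
  exact Finset.sum_congr rfl fun a _ => Finset.sum_congr rfl fun b _ => by ring

variable {ι κ : Type*} [Fintype ι] [Fintype κ] [DecidableEq ι] [DecidableEq κ]

theorem det_gram_sumElim_of_inner_eq_zero {v : ι → V} {w : κ → V}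
    (hvw : ∀ i j, inner ℝ (v i) (w j) = 0) :
    (Matrix.gram ℝ (Sum.elim v w)).det = (Matrix.gram ℝ v).det * (Matrix.gram ℝ w).det := by
  have hblocks : Matrix.gram ℝ (Sum.elim v w) =
      Matrix.fromBlocks (Matrix.gram ℝ v) 0 0 (Matrix.gram ℝ w) := by
    ext (i | i) (j | j)
    · rfl
    · exact hvw i j
    · exact (real_inner_comm _ _).trans (hvw j i)
    · rfl
  rw [hblocks, Matrix.det_fromBlocks_zero₂₁]

theorem det_gram_sumElim_basis (T : Submodule ℝ V) [T.HasOrthogonalProjection]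
    (v : Module.Basis ι ℝ T) (w : κ → V) :
    (Matrix.gram ℝ (Sum.elim (fun i => (v i : V)) w)).det =
      (Matrix.gram ℝ v).det * (Matrix.gram ℝ fun j => Tᗮ.starProjection (w j)).det := by
  let c : Matrix κ ι ℝ := Matrix.of fun j i => v.repr (T.orthogonalProjectionOnto (w j)) i
  have hw (j : κ) : w j = ∑ i, c j i • (v i : V) + Tᗮ.starProjection (w j) := by
    have hproj := congrArg (Subtype.val) (v.sum_repr (T.orthogonalProjectionOnto (w j)))
    rw [Submodule.coe_sum] at hproj
    conv_lhs => rw [← T.starProjection_add_starProjection_orthogonal (w j)]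
    exact congrArg (· + _) hproj.symm
  have hL : Sum.elim (fun i => (v i : V)) w = fun i => ∑ j,
      Matrix.fromBlocks 1 0 c 1 i j •
        Sum.elim (fun i => (v i : V)) (fun j => Tᗮ.starProjection (w j)) j := by
    ext (i | j)
    · simp [Matrix.one_apply]
    · simpa [Matrix.one_apply] using hw j
  rw [hL, gram_sum_smul, Matrix.det_mul, Matrix.det_mul, Matrix.det_transpose,
    Matrix.det_fromBlocks_zero₁₂, Matrix.det_one, Matrix.det_one, one_mul, one_mul, mul_one,
    det_gram_sumElim_of_inner_eq_zero fun i j =>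
      Tᗮ.starProjection_apply_mem (w j) _ (v i).2]
  rfl

theorem fderiv_det_apply_eq_zero {E : Type*} [NormedAddCommGroup E] [NormedSpace ℝ E]
    {A : E → Matrix ι ι ℝ} {u e : E} (hA : ∀ i j, DifferentiableAt ℝ (fun y => A y i j) u)
    (he : ∀ i j, fderiv ℝ (fun y => A y i j) u e = 0) :
    fderiv ℝ (fun y => (A y).det) u e = 0 := by
  have hterm (s : Equiv.Perm ι) := (HasFDerivAt.finsetProd (u := Finset.univ)
    fun i _ => (hA (s i) i).hasFDerivAt).fun_const_smul (Equiv.Perm.sign s)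
  simp only [Matrix.det_apply]
  rw [(HasFDerivAt.fun_sum fun s _ => hterm s).fderiv]
  simp [he]

end GramDeterminant

section TransverseDensity

theorem inner_eq_inner_orthogonalProjectionOnto_add {V : Type*} [NormedAddCommGroup V]
    [InnerProductSpace ℝ V] (T : Submodule ℝ V) [T.HasOrthogonalProjection] (a b : V) :
    inner ℝ a b = inner ℝ (T.orthogonalProjectionOnto a) (T.orthogonalProjectionOnto b) +
      inner ℝ (Tᗮ.starProjection a) (Tᗮ.starProjection b) := by
  rw [Submodule.inner_orthogonalProjectionOnto_eq_of_mem_left, Submodule.starProjection_apply Tᗮ a,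
    Submodule.starProjection_apply Tᗮ b, ← Submodule.coe_inner,
    Submodule.inner_orthogonalProjectionOnto_eq_of_mem_left, ← inner_add_left]
  exact congrArg (inner ℝ · b) (T.starProjection_add_starProjection_orthogonal a).symm

variable {n p k : ℕ} {M : Type*} [TopologicalSpace M] [ChartedSpace (Model n) M]
  {φ : OpenPartialHomeomorph M (Model n)}
  [RiemannianBundle (fun x : M => TangentSpace (𝓡 n) x)] {F : Foliation n M p}

theorem normalMetric_eq (hφ : IsFlatChart p F.tangent φ) (v w : Model n) {u : Model n}
    (hu : u ∈ φ.target) : normalMetric F φ v w u = chartMetric φ u v w -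
      ∑ i, chartMetric φ u (frameVec F φ i u) v * chartMetric φ u (frameVec F φ i u) w := by
  have hframe (i : Fin p) (v : Model n) : chartMetric φ u (frameVec F φ i u) v =
      inner ℝ (leafFrame F φ u i)
        ((F.tangent (φ.symm u)).orthogonalProjectionOnto (chartInvDeriv φ u v)) := by
    rw [frameVec, chartMetric, chartInvDeriv_chartDeriv hφ.1 hu,
      Submodule.inner_orthogonalProjectionOnto_eq_of_mem_left]
  simp only [hframe]
  rw [normalMetric, chartMetric, inner_eq_inner_orthogonalProjectionOnto_add
    (F.tangent (φ.symm u)) (chartInvDeriv φ u v), ← (leafFrame F φ u).sum_inner_mul_inner,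
    eq_sub_iff_add_eq, add_comm]
  congr 1
  exact Finset.sum_congr rfl fun i _ => by rw [real_inner_comm]

/-- The density of the Riemannian volume in the chart `φ` relative to the leafwise volume form,
`√(det g_{ij}) / χ_𝓕(∂₁, …, ∂_p)`. -/
def transDensity (o : ∀ x : M, Orientation ℝ (F.tangent x) (Fin p))
    (φ : OpenPartialHomeomorph M (Model n)) (u : Model n) : ℝ :=
  volDensity φ u / chartForm (volForm o) φ u (leafVec n)

variable (o : ∀ x : M, Orientation ℝ (F.tangent x) (Fin p))

theorem sq_chartForm_volForm (u : Model n) :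
    chartForm (volForm o) φ u (leafVec n) ^ 2 = (Matrix.gram ℝ (coordField F φ u)).det :=
  volumeForm_apply_sq_eq_det_gram (o (φ.symm u)) (coordField F φ u)

theorem chartForm_volForm_ne_zero (hφ : IsFlatChart p F.tangent φ) {u : Model n}
    (hu : u ∈ φ.target) : chartForm (volForm o) φ u (leafVec n) ≠ 0 := by
  have hgram : (Matrix.gram ℝ (coordField F φ u)).PosDef :=
    Matrix.posDef_gram_iff_linearIndependent.2 (linearIndependent_coordField hφ hu)
  exact (pow_ne_zero_iff two_ne_zero).1 ((sq_chartForm_volForm o u).trans_ne hgram.det_pos.ne')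

theorem transDensity_ne_zero (hφ : IsFlatChart p F.tangent φ) {u : Model n}
    (hu : u ∈ φ.target) : transDensity o φ u ≠ 0 :=
  div_ne_zero (volDensity_pos hφ.1 hu).ne' (chartForm_volForm_ne_zero o hφ hu)

theorem det_gramMatrix_eq (hφ : IsFlatChart p F.tangent φ) {q : ℕ} (hpq : p + q = n)
    {u : Model n} (hu : u ∈ φ.target) :
    (gramMatrix φ u).det = (Matrix.gram ℝ (coordField F φ u)).det *
      (Matrix.of fun i j : Fin q =>
        normalMetric F φ (EuclideanSpace.basisFun (Fin n) ℝ (blockEquiv hpq (.inr i)))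
          (EuclideanSpace.basisFun (Fin n) ℝ (blockEquiv hpq (.inr j))) u).det := by
  let b := basisOfLinearIndependentOfCardEqFinrank' (coordField F φ u)
    (linearIndependent_coordField hφ hu) (by rw [Fintype.card_fin, F.finrank_tangent])
  have hb : ⇑b = coordField F φ u := coe_basisOfLinearIndependentOfCardEqFinrank' ..
  have hfields : (fun s => chartInvDeriv φ u
      (EuclideanSpace.basisFun (Fin n) ℝ (blockEquiv hpq s))) =
      Sum.elim (fun i => (b i : TangentSpace (𝓡 n) (φ.symm u))) fun j =>
        chartInvDeriv φ u (EuclideanSpace.basisFun (Fin n) ℝ (blockEquiv hpq (.inr j))) := by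
    ext (i | j) : 1
    · rw [Sum.elim_inl, hb, coe_coordField hφ hu, leafVec_eq_basisFun (F.le (φ.symm u))]
      rfl
    · rfl
  rw [← Matrix.det_submatrix_equiv_self (blockEquiv hpq)]
  refine (congrArg (fun v => (Matrix.gram ℝ v).det) hfields).trans ?_
  rw [det_gram_sumElim_basis, hb]
  rfl

theorem transDensity_sq (hφ : IsFlatChart p F.tangent φ) {q : ℕ} (hpq : p + q = n)
    {u : Model n} (hu : u ∈ φ.target) :
    transDensity o φ u ^ 2 = (Matrix.of fun i j : Fin q =>
      normalMetric F φ (EuclideanSpace.basisFun (Fin n) ℝ (blockEquiv hpq (.inr i)))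
        (EuclideanSpace.basisFun (Fin n) ℝ (blockEquiv hpq (.inr j))) u).det := by
  rw [transDensity, div_pow, volDensity_eq_sqrt_det, Real.sq_sqrt (det_gramMatrix_pos hφ.1 hu).le,
    div_eq_iff (pow_ne_zero 2 (chartForm_volForm_ne_zero o hφ hu)), sq_chartForm_volForm,
    det_gramMatrix_eq hφ hpq hu, mul_comm]

variable [IsManifold (𝓡 n) ∞ M]
  [IsContMDiffRiemannianBundle (𝓡 n) ∞ (Model n) (fun x : M => TangentSpace (𝓡 n) x)]

theorem contDiffOn_normalMetric (hφ : IsFlatChart p F.tangent φ) (v w : Model n) :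
    ContDiffOn ℝ ∞ (normalMetric F φ v w) φ.target := by
  have hcoeff (i : Fin p) (v : Model n) :
      ContDiffOn ℝ ∞ (fun u => chartMetric φ u (frameVec F φ i u) v) φ.target :=
    contDiffOn_chartMetric hφ.1 (contDiffOn_frameVec hφ i) contDiffOn_const
  exact ((contDiffOn_chartMetric_const hφ.1 v w).sub (ContDiffOn.sum fun i _ =>
    (hcoeff i v).mul (hcoeff i w))).congr fun u hu => normalMetric_eq hφ v w hu

theorem contDiffOn_transDensity (ho : IsLeafOrientation o) (hφ : IsFlatChart p F.tangent φ) :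
    ContDiffOn ℝ ∞ (transDensity o φ) φ.target :=
  (contDiffOn_volDensity hφ.1).div
    (contDiffOn_apply ((isSmooth_volForm o ho).contDiffOn_chartForm hφ.1) fun _ => contDiffOn_const)
    fun _ hu => chartForm_volForm_ne_zero o hφ hu

theorem fderiv_transDensity (hF : IsBundleLike F) (ho : IsLeafOrientation o)
    (hφ : IsFlatChart p F.tangent φ) {u : Model n} (hu : u ∈ φ.target) {e : Model n}
    (he : e ∈ leafModel n p) : fderiv ℝ (transDensity o φ) u e = 0 := by
  obtain ⟨q, rfl⟩ := Nat.exists_eq_add_of_le (F.le (φ.symm u))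
  have hnhds := φ.open_target.mem_nhds hu
  have hsq : fderiv ℝ (fun y => transDensity o φ y ^ 2) u e = 0 := by
    rw [Filter.EventuallyEq.fderiv_eq
      (Filter.eventually_of_mem hnhds fun y hy => transDensity_sq o hφ rfl hy)]
    exact fderiv_det_apply_eq_zero
      (fun i j => ((contDiffOn_normalMetric hφ _ _).contDiffAt hnhds).differentiableAt (by simp))
      fun i j => hF φ hφ _ _ u hu e he
  have hdiff : DifferentiableAt ℝ (transDensity o φ) u :=
    ((contDiffOn_transDensity o ho hφ).contDiffAt hnhds).differentiableAt (by simp)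
  simpa [fderiv_fun_pow 2 hdiff, transDensity_ne_zero o hφ hu] using hsq

end TransverseDensity

section Leibniz

theorem fderiv_wedgeAlt_apply {n k l m : ℕ} (h : k + l = m)
    {A : Model n → Model n [⋀^Fin k]→L[ℝ] ℝ} {B : Model n → Model n [⋀^Fin l]→L[ℝ] ℝ}
    {u : Model n} (hA : DifferentiableAt ℝ A u) (hB : DifferentiableAt ℝ B u) (w : Model n)
    (v : Fin m → Model n) :
    fderiv ℝ (fun y => wedgeAlt h (A y).toAlternatingMap (B y).toAlternatingMap v) u w =
      wedgeAlt h (fderiv ℝ A u w).toAlternatingMap (B u).toAlternatingMap v +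
        wedgeAlt h (A u).toAlternatingMap (fderiv ℝ B u w).toAlternatingMap v := by
  have happly {j : ℕ} {C : Model n → Model n [⋀^Fin j]→L[ℝ] ℝ} (hC : DifferentiableAt ℝ C u)
      (x : Fin j → Model n) := (ContinuousAlternatingMap.apply ℝ (Model n) ℝ x).hasFDerivAt.comp
    u hC.hasFDerivAt
  have hsum := (HasFDerivAt.fun_sum (u := Finset.univ) fun (s : Equiv.Perm (Fin m)) _ =>
    ((happly hA fun i => v (s (blockEquiv h (.inl i)))).mul
      (happly hB fun j => v (s (blockEquiv h (.inr j))))).const_mul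
        ((Equiv.Perm.sign s : ℤ) : ℝ)).const_mul ((k.factorial : ℝ) * l.factorial)⁻¹
  simp only [wedgeAlt_apply, antisymSum]
  rw [← mul_add, ← Finset.sum_add_distrib]
  refine (DFunLike.congr_fun hsum.fderiv w).trans ?_
  simp only [_root_.smul_apply, _root_.sum_apply, _root_.add_apply, ContinuousLinearMap.comp_apply,
    smul_eq_mul, Function.comp_apply, ContinuousAlternatingMap.apply_apply]
  congr 1
  refine Finset.sum_congr rfl fun s _ => ?_
  simp only [ContinuousAlternatingMap.coe_toAlternatingMap]
  ring

theorem extDeriv_wedgeAlt {n k l m : ℕ} (h : k + l = m)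
    {A : Model n → Model n [⋀^Fin k]→L[ℝ] ℝ} {B : Model n → Model n [⋀^Fin l]→L[ℝ] ℝ}
    {C : Model n → Model n [⋀^Fin m]→L[ℝ] ℝ}
    (hC : ∀ y, (C y).toAlternatingMap = wedgeAlt h (A y).toAlternatingMap (B y).toAlternatingMap)
    {u : Model n} (hA : DifferentiableAt ℝ A u) (hB : DifferentiableAt ℝ B u)
    (hCu : DifferentiableAt ℝ C u) :
    (extDeriv C u).toAlternatingMap =
      wedgeAlt (by omega : k + 1 + l = m + 1) (extDeriv A u).toAlternatingMap
          (B u).toAlternatingMap +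
        (-1 : ℝ) ^ k • wedgeAlt (by omega : k + (l + 1) = m + 1) (A u).toAlternatingMap
          (extDeriv B u).toAlternatingMap := by
  simp only [extDeriv, ContinuousAlternatingMap.toAlternatingMap_alternatizeUncurryFin]
  rw [wedgeAlt_alternatizeUncurryFin_left h, wedgeAlt_alternatizeUncurryFin_right h,
    ← AlternatingMap.alternatizeUncurryFin_add]
  congr 1
  ext w v
  have happly := ((ContinuousAlternatingMap.apply ℝ (Model n) ℝ v).hasFDerivAt.comp
    u hCu.hasFDerivAt).fderiv
  refine (DFunLike.congr_fun happly w).symm.trans ?_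
  rw [show (ContinuousAlternatingMap.apply ℝ (Model n) ℝ v) ∘ C = fun y => wedgeAlt h
    (A y).toAlternatingMap (B y).toAlternatingMap v from
      funext fun y => DFunLike.congr_fun (hC y) v, fderiv_wedgeAlt_apply h hA hB]
  rfl

end Leibniz

section DivergenceTheorem

theorem contDiff_indicator_of_support_subset {E G : Type*} [NormedAddCommGroup E] [NormedSpace ℝ E]
    [NormedAddCommGroup G] [NormedSpace ℝ G] {U K : Set E} (hU : IsOpen U) (hK : IsClosed K)
    (hKU : K ⊆ U) {g : E → G} {r : WithTop ℕ∞} (hg : ContDiffOn ℝ r g U)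
    (h0 : ∀ u ∈ U, u ∉ K → g u = 0) : ContDiff ℝ r (U.indicator g) := by
  have hsupp : tsupport (U.indicator g) ⊆ K := by
    refine closure_minimal (fun u hu => ?_) hK
    by_contra huK
    exact hu (Set.indicator_apply_eq_zero.2 fun huU => h0 u huU huK)
  refine contDiff_iff_contDiffAt.2 fun u => ?_
  by_cases hu : u ∈ tsupport (U.indicator g)
  · have hnhds := hU.mem_nhds (hKU (hsupp hu))
    exact (hg.contDiffAt hnhds).congr_of_eventuallyEq
      (Filter.eventually_of_mem hnhds fun y hy => Set.indicator_of_mem hy g)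
  · exact contDiffAt_const.congr_of_eventuallyEq (notMem_tsupport_iff_eventuallyEq.1 hu)

variable {E : Type*} [NormedAddCommGroup E] [NormedSpace ℝ E] [MeasurableSpace E] [BorelSpace E]
  (μ : Measure E)

theorem integrable_fderiv_of_hasCompactSupport [IsFiniteMeasureOnCompacts μ] {G : E → ℝ}
    (hG : ContDiff ℝ 1 G) (hc : HasCompactSupport G) (e : E) :
    Integrable (fun u => fderiv ℝ G u e) μ :=
  ((hG.continuous_fderiv one_ne_zero).clm_apply
    continuous_const).integrable_of_hasCompactSupport (hc.fderiv_apply ℝ e)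

variable [FiniteDimensional ℝ E] [μ.IsAddHaarMeasure]

theorem integral_fderiv_eq_zero_of_hasCompactSupport {G : E → ℝ} (hG : ContDiff ℝ 1 G)
    (hc : HasCompactSupport G) (e : E) : ∫ u, fderiv ℝ G u e ∂μ = 0 := by
  have hparts := integral_mul_fderiv_eq_neg_fderiv_mul_of_integrable (μ := μ)
    (f := fun _ : E => (1 : ℝ)) (g := G) (v := e) (by simp)
    (by simpa using integrable_fderiv_of_hasCompactSupport μ hG hc e)
    (by simpa using hG.continuous.integrable_of_hasCompactSupport hc) (by simp)
    (fun u _ => hG.differentiable (by simp) u)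
  simpa using hparts

theorem integrableOn_fderiv_and_setIntegral_eq_zero {U K : Set E} (hU : IsOpen U)
    (hK : IsCompact K) (hKU : K ⊆ U) {g : E → ℝ} (hg : ContDiffOn ℝ 1 g U)
    (h0 : ∀ u ∈ U, u ∉ K → g u = 0) (e : E) :
    IntegrableOn (fun u => fderiv ℝ g u e) U μ ∧ ∫ u in U, fderiv ℝ g u e ∂μ = 0 := by
  have hsmooth := contDiff_indicator_of_support_subset hU hK.isClosed hKU hg h0
  have hzero (u : E) (hu : u ∉ K) : U.indicator g u = 0 :=
    Set.indicator_apply_eq_zero.2 fun huU => h0 u huU hu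
  have hcompact : HasCompactSupport (U.indicator g) := HasCompactSupport.intro hK hzero
  have heq : Set.EqOn (fun u => fderiv ℝ (U.indicator g) u e) (fun u => fderiv ℝ g u e) U :=
    fun u hu => DFunLike.congr_fun (Filter.EventuallyEq.fderiv_eq
      (Filter.eventually_of_mem (hU.mem_nhds hu) fun y hy => Set.indicator_of_mem hy g)) e
  have hoff (u : E) (hu : u ∉ U) : fderiv ℝ (U.indicator g) u e = 0 := by
    rw [Filter.EventuallyEq.fderiv_eq (Filter.eventually_of_mem
      (hK.isClosed.isOpen_compl.mem_nhds fun huK => hu (hKU huK)) hzero)]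
    simp
  refine ⟨(integrable_fderiv_of_hasCompactSupport μ hsmooth hcompact e).integrableOn.congr_fun heq
    hU.measurableSet, ?_⟩
  rw [← setIntegral_congr_fun hU.measurableSet heq,
    setIntegral_eq_integral_of_forall_compl_eq_zero hoff]
  exact integral_fderiv_eq_zero_of_hasCompactSupport μ hsmooth hcompact e

end DivergenceTheorem

section TopDegree

variable {V : Type*} [NormedAddCommGroup V] [InnerProductSpace ℝ V] [FiniteDimensional ℝ V]
  {p : ℕ} [Fact (Module.finrank ℝ V = p)] (o : Orientation ℝ V (Fin p))

theorem innerAlt_volumeForm_self : innerAlt o.volumeForm o.volumeForm = 1 := by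
  let e := (stdOrthonormalBasis ℝ V).reindex (finCongr (Fact.out : Module.finrank ℝ V = p))
  have hsum := sum_eq_factorial_mul_of_comp_perm (Equiv.sumEmpty (Fin p) (Fin 0))
    (fun I => o.volumeForm (e ∘ I) * o.volumeForm (e ∘ I))
    (fun I hI => ?_) fun τ => ?_
  · rw [innerAlt_eq_sum e]
    refine (congrArg _ hsum).trans ?_
    rw [Fintype.card_fin, inv_mul_cancel_left₀ (by positivity)]
    exact volumeForm_apply_mul_self o e
  · have hvol : o.volumeForm (e ∘ I) = 0 :=
      o.volumeForm.map_eq_zero_of_not_injective _ fun hinj => hI (by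
        rw [Sum.elim_injective]
        exact ⟨hinj.of_comp, Function.injective_of_subsingleton _, fun _ j => j.elim0⟩)
    rw [hvol, zero_mul]
  · simp only [← Function.comp_assoc, alternatingMap_comp_perm]
    rw [mul_mul_mul_comm, sign_mul_self, one_mul]

theorem eq_innerAlt_smul_volumeForm (τ : V [⋀^Fin p]→ₗ[ℝ] ℝ) :
    τ = innerAlt τ o.volumeForm • o.volumeForm := by
  let e := (stdOrthonormalBasis ℝ V).reindex (finCongr (Fact.out : Module.finrank ℝ V = p))
  rw [eq_smul_volumeForm o e τ, innerAlt_smul_left, innerAlt_volumeForm_self, mul_one]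

end TopDegree

section LeafwiseDerivative

variable {n p k l m : ℕ} {M : Type*} [TopologicalSpace M] [ChartedSpace (Model n) M]
  {φ : OpenPartialHomeomorph M (Model n)}
  [RiemannianBundle (fun x : M => TangentSpace (𝓡 n) x)] {F : Foliation n M p}

theorem chartForm_wedge (h : k + l = m) (α : LeafForm F k)
    (γ : LeafForm F l) (u : Model n) :
    (chartForm (wedge h α γ) φ u).toAlternatingMap =
      wedgeAlt h (chartForm α φ u).toAlternatingMap (chartForm γ φ u).toAlternatingMap :=
  (wedgeAlt_compLinearMap h _ _ _).symm

theorem leafD_eq_zero_of_notMem {α : LeafForm F k} {K : Set M}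
    (hK : IsClosed K) (h0 : ∀ x, x ∉ K → α x = 0) {x : M} (hx : x ∉ K) : leafD α x = 0 := by
  have hnhds : (chartAt (Model n) x).symm ⁻¹' Kᶜ ∈ nhds (chartAt (Model n) x x) := by
    refine ((chartAt (Model n) x).continuousAt_symm
      (mem_chart_target _ x)).preimage_mem_nhds (hK.isOpen_compl.mem_nhds ?_)
    rwa [(chartAt (Model n) x).left_inv (mem_chart_source _ x)]
  have hchart : chartForm α (chartAt (Model n) x) =ᶠ[nhds (chartAt (Model n) x x)] fun _ => 0 :=
    Filter.mem_of_superset hnhds fun u hu => by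
      ext v
      rw [chartForm_apply, h0 _ hu]
      rfl
  rw [leafD, hchart.extDeriv_eq, extDeriv, fderiv_const_apply]
  ext v
  simp [ContinuousAlternatingMap.alternatizeUncurryFin_apply]

theorem chartForm_compLinearMap_chartDeriv (α : LeafForm F k)
    (hφ : φ ∈ IsManifold.maximalAtlas (𝓡 n) ∞ M) {u : Model n} (hu : u ∈ φ.target) :
    (chartForm α φ u).toAlternatingMap.compLinearMap
      ((chartDeriv φ (φ.symm u)).toLinearMap ∘ₗ (F.tangent (φ.symm u)).subtype) =
        α (φ.symm u) := by
  ext v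
  refine (chartForm_chartDeriv hφ α hu fun i => (v i : TangentSpace (𝓡 n) (φ.symm u))).trans ?_
  simp

variable [IsManifold (𝓡 n) ∞ M]

theorem IsSmooth.differentiableAt_chartForm {α : LeafForm F k}
    (hα : IsSmooth α) (hφ : φ ∈ IsManifold.maximalAtlas (𝓡 n) ∞ M) {u : Model n}
    (hu : u ∈ φ.target) : DifferentiableAt ℝ (chartForm α φ) u :=
  ((hα.contDiffOn_chartForm hφ).contDiffAt (φ.open_target.mem_nhds hu)).differentiableAt (by simp)

theorem leafD_eq_symm {α : LeafForm F k} (hα : IsSmooth α)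
    (hφ : φ ∈ IsManifold.maximalAtlas (𝓡 n) ∞ M) {u : Model n} (hu : u ∈ φ.target) :
    leafD α (φ.symm u) = (extDeriv (chartForm α φ) u).toAlternatingMap.compLinearMap
      ((chartDeriv φ (φ.symm u)).toLinearMap ∘ₗ (F.tangent (φ.symm u)).subtype) :=
  AlternatingMap.ext (leafD_apply_symm hα hφ hu)

theorem leafD_add {α β : LeafForm F k} (hα : IsSmooth α) (hβ : IsSmooth β) :
    leafD (α + β) = leafD α + leafD β := by
  funext x
  have hchart : chartForm (α + β) (chartAt (Model n) x) =
    chartForm α (chartAt (Model n) x) + chartForm β (chartAt (Model n) x) := rfl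
  have hx := IsManifold.chart_mem_maximalAtlas (I := 𝓡 n) (n := ∞) x
  rw [Pi.add_apply, leafD, hchart, extDeriv_add
    (hα.differentiableAt_chartForm hx (mem_chart_target _ x))
    (hβ.differentiableAt_chartForm hx (mem_chart_target _ x))]
  rfl

variable [IsContMDiffRiemannianBundle (𝓡 n) ∞ (Model n) (fun x : M => TangentSpace (𝓡 n) x)]

theorem leafD_wedge (h : k + l = m) {α : LeafForm F k} (hα : IsSmooth α)
    {γ : LeafForm F l} (hγ : IsSmooth γ) :
    leafD (wedge h α γ) = wedge (by omega) (leafD α) γ +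
      (-1 : ℝ) ^ k • wedge (by omega) α (leafD γ) := by
  funext x
  obtain ⟨φ, hφ, u, hu, rfl⟩ : ∃ φ ∈ IsManifold.maximalAtlas (𝓡 n) ∞ M, ∃ u ∈ φ.target,
      φ.symm u = x := ⟨chartAt (Model n) x, IsManifold.chart_mem_maximalAtlas x, _,
    mem_chart_target _ x, (chartAt (Model n) x).left_inv (mem_chart_source _ x)⟩
  rw [Pi.add_apply, Pi.smul_apply, wedge, wedge, leafD_eq_symm (hα.wedge h hγ) hφ hu,
    leafD_eq_symm hα hφ hu, leafD_eq_symm hγ hφ hu,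
    extDeriv_wedgeAlt h (chartForm_wedge h α γ) (hα.differentiableAt_chartForm hφ hu)
      (hγ.differentiableAt_chartForm hφ hu) ((hα.wedge h hγ).differentiableAt_chartForm hφ hu)]
  conv_rhs => rw [← chartForm_compLinearMap_chartDeriv α hφ hu,
    ← chartForm_compLinearMap_chartDeriv γ hφ hu, wedgeAlt_compLinearMap, wedgeAlt_compLinearMap]
  rfl

end LeafwiseDerivative

section Stokes

variable {n p k : ℕ} {M : Type*} [TopologicalSpace M] [ChartedSpace (Model n) M]
  [IsManifold (𝓡 n) ∞ M] {φ : OpenPartialHomeomorph M (Model n)}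
  [RiemannianBundle (fun x : M => TangentSpace (𝓡 n) x)]

theorem leafD_apply_coordField {F : Foliation n M (k + 1)} (hφ : IsFlatChart (k + 1) F.tangent φ)
    {ξ : LeafForm F k} (hξ : IsSmooth ξ) {u : Model n} (hu : u ∈ φ.target) :
    leafD ξ (φ.symm u) (coordField F φ u) = ∑ i : Fin (k + 1), (-1 : ℝ) ^ (i : ℕ) *
      fderiv ℝ (fun y => chartForm ξ φ y (i.removeNth (leafVec n))) u (leafVec n i) := by
  rw [leafD_apply_symm hξ hφ.1 hu, extDeriv_apply (hξ.differentiableAt_chartForm hφ.1 hu)]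
  simp only [chartDeriv_coordField hφ hu, zsmul_eq_mul, Int.cast_pow, Int.cast_neg, Int.cast_one]

theorem contDiffOn_chartForm_removeNth_leafVec {F : Foliation n M (k + 1)} {ξ : LeafForm F k}
    (hξ : IsSmooth ξ) (hφ : IsFlatChart (k + 1) F.tangent φ) (i : Fin (k + 1)) :
    ContDiffOn ℝ ∞ (fun y => chartForm ξ φ y (i.removeNth (leafVec n))) φ.target :=
  contDiffOn_apply (hξ.contDiffOn_chartForm hφ.1) fun _ => contDiffOn_const

theorem IsSmooth.induction_on_support [T2Space M] [CompactSpace M]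
    [IsContMDiffRiemannianBundle (𝓡 n) ∞ (Model n) (fun x : M => TangentSpace (𝓡 n) x)]
    {F : Foliation n M p}
    {P : LeafForm F k → Prop} {α : LeafForm F k} (hα : IsSmooth α) (zero : P 0)
    (add : ∀ β γ, IsSmooth β → IsSmooth γ → P β → P γ → P (β + γ))
    (of_support : ∀ φ, IsFlatChart p F.tangent φ → ∀ K ⊆ φ.source, IsClosed K →
      ∀ β, IsSmooth β → (∀ x ∉ K, β x = 0) → P β) : P α := by
  classical
  choose φ hxφ hφ using F.exists_flatChart
  obtain ⟨ρ, hρ⟩ := SmoothPartitionOfUnity.exists_isSubordinate (𝓡 n) (isClosed_univ (X := M))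
    (fun x : M => (φ x).source) (fun x => (φ x).open_source)
    (fun x _ => Set.mem_iUnion.2 ⟨x, hxφ x⟩)
  have hfin : {i | (Function.support (ρ i)).Nonempty}.Finite :=
    ρ.locallyFinite.finite_nonempty_of_compact
  have hsmooth (i : M) : IsSmooth (fun x => ρ i x • α x : LeafForm F k) :=
    hα.smul (ρ i).contMDiff
  have hlocal (i : M) : P (fun x => ρ i x • α x) :=
    of_support (φ i) (hφ i) _ (hρ i) (isClosed_tsupport (ρ i)) _ (hsmooth i) fun x hx => by
      rw [image_eq_zero_of_notMem_tsupport hx, zero_smul]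
  have hsum (t : Finset M) : IsSmooth (∑ i ∈ t, fun x => ρ i x • α x : LeafForm F k) ∧
      P (∑ i ∈ t, fun x => ρ i x • α x) := by
    induction t using Finset.induction_on with
    | empty => exact ⟨isSmooth_zero, zero⟩
    | insert i t hi ih =>
      rw [Finset.sum_insert hi]
      exact ⟨(hsmooth i).add ih.1, add _ _ (hsmooth i) ih.1 (hlocal i) ih.2⟩
  have hα_eq : (∑ i ∈ hfin.toFinset, fun x => ρ i x • α x : LeafForm F k) = α := by
    funext x
    have hone := ρ.sum_eq_one (Set.mem_univ x)
    rw [finsum_eq_sum_of_support_subset (s := hfin.toFinset) _ fun i hi =>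
      hfin.mem_toFinset.2 ⟨x, hi⟩] at hone
    rw [Finset.sum_apply, ← Finset.sum_smul, hone, one_smul]
  exact hα_eq ▸ (hsum hfin.toFinset).2

variable {F : Foliation n M (k + 1)} (o : ∀ x : M, Orientation ℝ (F.tangent x) (Fin (k + 1)))
  [IsContMDiffRiemannianBundle (𝓡 n) ∞ (Model n) (fun x : M => TangentSpace (𝓡 n) x)]

theorem volDensity_mul_innerAlt_leafD_volForm (hF : IsBundleLike F) (ho : IsLeafOrientation o)
    (hφ : IsFlatChart (k + 1) F.tangent φ) {ξ : LeafForm F k} (hξ : IsSmooth ξ) {u : Model n}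
    (hu : u ∈ φ.target) :
    volDensity φ u * innerAlt (leafD ξ (φ.symm u)) (volForm o (φ.symm u)) =
      ∑ i : Fin (k + 1), (-1 : ℝ) ^ (i : ℕ) * fderiv ℝ (fun y =>
        transDensity o φ y * chartForm ξ φ y (i.removeNth (leafVec n))) u (leafVec n i) := by
  have hnhds := φ.open_target.mem_nhds hu
  have hχ := chartForm_volForm_ne_zero o hφ hu
  have htop : leafD ξ (φ.symm u) (coordField F φ u) =
      innerAlt (leafD ξ (φ.symm u)) (volForm o (φ.symm u)) *
        chartForm (volForm o) φ u (leafVec n) :=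
    DFunLike.congr_fun (eq_innerAlt_smul_volumeForm (o (φ.symm u)) (leafD ξ (φ.symm u)))
      (coordField F φ u)
  calc volDensity φ u * innerAlt (leafD ξ (φ.symm u)) (volForm o (φ.symm u))
    _ = transDensity o φ u * leafD ξ (φ.symm u) (coordField F φ u) := by
        rw [htop, transDensity]
        field_simp
    _ = _ := by
        rw [leafD_apply_coordField hφ hξ hu, Finset.mul_sum]
        refine Finset.sum_congr rfl fun i _ => ?_
        rw [fderiv_fun_mul
          (((contDiffOn_transDensity o ho hφ).contDiffAt hnhds).differentiableAt (by simp))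
          (((contDiffOn_chartForm_removeNth_leafVec hξ hφ i).contDiffAt hnhds).differentiableAt
            (by simp))]
        simp only [_root_.add_apply, _root_.smul_apply, smul_eq_mul,
          fderiv_transDensity o hF ho hφ hu (leafVec_mem i), mul_zero, add_zero]
        ring

variable [MeasurableSpace M] [BorelSpace M] [CompactSpace M]

theorem l2Inner_add_left {p j : ℕ} {F : Foliation n M p} {α β γ : LeafForm F j} (hα : IsSmooth α)
    (hβ : IsSmooth β) (hγ : IsSmooth γ) :
    l2Inner (α + β) γ = l2Inner α γ + l2Inner β γ := by
  simp only [l2Inner, Pi.add_apply, innerAlt_add_left]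
  exact integral_add (integrable_of_continuous (hα.continuous_innerAlt hγ))
    (integrable_of_continuous (hβ.continuous_innerAlt hγ))

theorem l2Inner_leafD_volForm_of_support (hF : IsBundleLike F) (ho : IsLeafOrientation o)
    (hφ : IsFlatChart (k + 1) F.tangent φ) {K : Set M} (hKφ : K ⊆ φ.source) (hK : IsClosed K)
    {ξ : LeafForm F k} (hξ : IsSmooth ξ) (h0 : ∀ x ∉ K, ξ x = 0) :
    l2Inner (leafD ξ) (volForm o) = 0 := by
  have hoff (x : M) (hx : x ∉ K) : innerAlt (leafD ξ x) (volForm o x) = 0 := by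
    rw [leafD_eq_zero_of_notMem hK h0 hx]
    simp [innerAlt]
  have hKcompact : IsCompact (φ '' K) :=
    hK.isCompact.image_of_continuousOn (φ.continuousOn.mono hKφ)
  have hKtarget : φ '' K ⊆ φ.target := (Set.image_mono hKφ).trans φ.image_source_eq_target.subset
  have hterm (i : Fin (k + 1)) := integrableOn_fderiv_and_setIntegral_eq_zero volume φ.open_target
    hKcompact hKtarget (g := fun y => transDensity o φ y * chartForm ξ φ y
      (i.removeNth (leafVec n)))
    (((contDiffOn_transDensity o ho hφ).mul (contDiffOn_chartForm_removeNth_leafVec hξ hφ i)).of_le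
      (by exact_mod_cast le_top)) (fun u hu huK => by
        have hx : φ.symm u ∉ K := fun hmem => huK ⟨φ.symm u, hmem, φ.right_inv hu⟩
        rw [chartForm_apply, h0 _ hx, AlternatingMap.zero_apply, mul_zero]) (leafVec n i)
  rw [l2Inner, integral_riemannianVolume hφ.1
    (hξ.leafD.continuous_innerAlt (isSmooth_volForm o ho)) fun x hx => hoff x fun hxK =>
      hx (hKφ hxK), setIntegral_congr_fun φ.open_target.measurableSet fun u hu =>
        volDensity_mul_innerAlt_leafD_volForm o hF ho hφ hξ hu,
    integral_finsetSum _ fun i _ => (hterm i).1.const_mul _]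
  exact Finset.sum_eq_zero fun i _ => by rw [integral_const_mul, (hterm i).2, mul_zero]

variable [T2Space M]

theorem l2Inner_leafD_volForm (hF : IsBundleLike F) (ho : IsLeafOrientation o)
    {ξ : LeafForm F k} (hξ : IsSmooth ξ) : l2Inner (leafD ξ) (volForm o) = 0 := by
  refine hξ.induction_on_support ?_ (fun β γ hβ hγ hβ0 hγ0 => ?_)
    fun φ hφ K hKφ hK β hβ h0 => l2Inner_leafD_volForm_of_support o hF ho hφ hKφ hK hβ h0
  · have hzero (x : M) : leafD (0 : LeafForm F k) x = 0 :=
      leafD_eq_zero_of_notMem isClosed_empty (fun _ _ => rfl) (Set.notMem_empty x)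
    simp [l2Inner, hzero, innerAlt]
  · rw [leafD_add hβ hγ, l2Inner_add_left hβ.leafD hγ.leafD (isSmooth_volForm o ho), hβ0, hγ0,
      add_zero]

end Stokes

theorem neg_one_pow_mul_self (j : ℕ) : (-1 : ℝ) ^ j * (-1) ^ j = 1 :=
  pow_mul_pow_eq_one j (by norm_num)

section TwistedLeibniz

theorem wedgeAlt_one_wedgeAlt {V : Type*} [AddCommGroup V] [Module ℝ V] {k l m : ℕ}
    (h : k + l = m) (t : V [⋀^Fin 1]→ₗ[ℝ] ℝ) (a : V [⋀^Fin k]→ₗ[ℝ] ℝ) (b : V [⋀^Fin l]→ₗ[ℝ] ℝ) :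
    wedgeAlt (by omega : k + 1 + l = m + 1) (wedgeAlt (Nat.add_comm 1 k) t a) b =
      (-1 : ℝ) ^ k • wedgeAlt (by omega) a (wedgeAlt (Nat.add_comm 1 l) t b) := by
  have htensor : (wedgeBilin h).flip b ∘ₗ tensorAlt t a = wedgeBilin h a ∘ₗ tensorAlt t b := by
    ext1 w
    simp [tensorAlt]
  rw [wedgeAlt_one_left, wedgeAlt_one_left, wedgeAlt_alternatizeUncurryFin_left h, htensor,
    wedgeAlt_alternatizeUncurryFin_right h]

variable {n p k l m : ℕ} {M : Type*} [TopologicalSpace M] [ChartedSpace (Model n) M]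
  {F : Foliation n M p}

theorem wedge_smul_right (h : k + l = m) (c : ℝ) (α : LeafForm F k) (β : LeafForm F l) :
    wedge h α (c • β) = c • wedge h α β :=
  funext fun x => map_smul (wedgeBilin h (α x)) c (β x)

variable [RiemannianBundle (fun x : M => TangentSpace (𝓡 n) x)]

theorem leafD_smul (c : ℝ) (α : LeafForm F k) : leafD (c • α) = c • leafD α := by
  funext x
  have hchart : chartForm (c • α) (chartAt (Model n) x) = c • chartForm α (chartAt (Model n) x) :=
    rfl
  rw [Pi.smul_apply, leafD, hchart, extDeriv_smul c]
  rfl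

theorem twistedD_smul (η : LeafForm F 1) (c : ℝ) (α : LeafForm F k) :
    twistedD η (c • α) = c • twistedD η α := by
  rw [twistedD, leafD_smul, wedge_smul_right, ← smul_add, twistedD]

variable [IsManifold (𝓡 n) ∞ M]
  [IsContMDiffRiemannianBundle (𝓡 n) ∞ (Model n) (fun x : M => TangentSpace (𝓡 n) x)]

theorem leafD_wedge_eq_twistedD (h : k + l = m) (η : LeafForm F 1) {α : LeafForm F k}
    (hα : IsSmooth α) {γ : LeafForm F l} (hγ : IsSmooth γ) :
    leafD (wedge h α γ) = wedge (by omega) (twistedD η α) γ +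
      (-1 : ℝ) ^ k • wedge (by omega) α (twistedD (-η) γ) := by
  rw [leafD_wedge h hα hγ]
  funext x
  simp only [Pi.add_apply, Pi.smul_apply, Pi.neg_apply, wedge, twistedD, ← wedgeBilin_apply,
    map_add, map_neg, LinearMap.add_apply, LinearMap.neg_apply]
  simp only [wedgeBilin_apply, wedgeAlt_one_wedgeAlt h, smul_add, smul_neg]
  abel

end TwistedLeibniz

section L2Inner

variable {n p k : ℕ} {M : Type*} [TopologicalSpace M] [ChartedSpace (Model n) M]
  [RiemannianBundle (fun x : M => TangentSpace (𝓡 n) x)] [MeasurableSpace M]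
  {F : Foliation n M p}

theorem l2Inner_smul_right (c : ℝ) (α β : LeafForm F k) :
    l2Inner α (c • β) = c * l2Inner α β := by
  simp only [l2Inner, Pi.smul_apply, innerAlt_smul_right, integral_const_mul]

theorem l2Inner_smul_left (c : ℝ) (α β : LeafForm F k) :
    l2Inner (c • α) β = c * l2Inner α β := by
  simp only [l2Inner, Pi.smul_apply, innerAlt_smul_left, integral_const_mul]

variable [IsManifold (𝓡 n) ∞ M]
  [IsContMDiffRiemannianBundle (𝓡 n) ∞ (Model n) (fun x : M => TangentSpace (𝓡 n) x)]
  [BorelSpace M] [CompactSpace M]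

theorem l2Inner_sub_right {α β γ : LeafForm F k} (hα : IsSmooth α) (hβ : IsSmooth β)
    (hγ : IsSmooth γ) : l2Inner α (β - γ) = l2Inner α β - l2Inner α γ := by
  simp only [l2Inner, Pi.sub_apply, innerAlt_sub_right]
  exact integral_sub (integrable_of_continuous (hα.continuous_innerAlt hβ))
    (integrable_of_continuous (hα.continuous_innerAlt hγ))

theorem l2Inner_self_eq_zero {α : LeafForm F k} (hα : IsSmooth α) :
    l2Inner α α = 0 ↔ α = 0 := by
  have hcont := hα.continuous_innerAlt hα
  rw [l2Inner, integral_eq_zero_iff_of_nonneg (fun x => innerAlt_self_nonneg (α x))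
    (integrable_of_continuous hcont),
    hcont.ae_eq_iff_eq (riemannianVolume n M) continuous_zero, funext_iff, funext_iff]
  exact forall_congr' fun x => innerAlt_self_eq_zero

end L2Inner

section Star

variable {n p k l : ℕ} {M : Type*} [TopologicalSpace M] [ChartedSpace (Model n) M]
  {F : Foliation n M p}

theorem subsingleton_leafForm (h : p < k) : Subsingleton (LeafForm F k) := by
  have (x : M) : Subsingleton ((F.tangent x) [⋀^Fin k]→ₗ[ℝ] ℝ) := by
    refine subsingleton_of_forall_eq 0 fun a => AlternatingMap.ext fun v => ?_
    refine a.map_linearDependent v fun hv => ?_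
    have hcard := hv.fintype_card_le_finrank
    rw [Fintype.card_fin, F.finrank_tangent x] at hcard
    omega
  infer_instance

variable [RiemannianBundle (fun x : M => TangentSpace (𝓡 n) x)]
  (o : ∀ x : M, Orientation ℝ (F.tangent x) (Fin p))

theorem hodgeStar_smul (h : k + l = p) (c : ℝ) (β : LeafForm F k) :
    hodgeStar o h (c • β) = c • hodgeStar o h β :=
  funext fun x => starAlt_smul (o x) h c (β x)

theorem hodgeStar_add (h : k + l = p) (β γ : LeafForm F k) :
    hodgeStar o h (β + γ) = hodgeStar o h β + hodgeStar o h γ :=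
  funext fun x => starAlt_add (o x) h (β x) (γ x)

theorem hodgeStar_zero (h : k + l = p) : hodgeStar o h (0 : LeafForm F k) = 0 := by
  simpa using hodgeStar_smul o h 0 0

theorem hodgeStar_hodgeStar (h : k + l = p) (β : LeafForm F k) :
    hodgeStar o ((Nat.add_comm l k).trans h) (hodgeStar o h β) = (-1 : ℝ) ^ (k * l) • β :=
  funext fun x => starAlt_starAlt (o x) h (β x)

variable [MeasurableSpace M]

theorem l2Inner_wedge_hodgeStar (h : k + l = p) (α β : LeafForm F k) :
    l2Inner (wedge h α (hodgeStar o h β)) (volForm o) = l2Inner α β := by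
  simp only [l2Inner, wedge, hodgeStar, volForm, isStarAlt_starAlt (o _) h _ (α _),
    innerAlt_smul_left, innerAlt_volumeForm_self, mul_one]

theorem l2Inner_wedge_volForm (h : k + l = p) (α : LeafForm F k) (τ : LeafForm F l) :
    l2Inner (wedge h α τ) (volForm o) =
      (-1) ^ (l * k) * l2Inner α (hodgeStar o ((Nat.add_comm l k).trans h) τ) := by
  rw [← l2Inner_wedge_hodgeStar o h, hodgeStar_hodgeStar o ((Nat.add_comm l k).trans h),
    wedge_smul_right, l2Inner_smul_left, ← mul_assoc, neg_one_pow_mul_self, one_mul]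

end Star

section Adjoint

variable {n p k l : ℕ} {M : Type*} [TopologicalSpace M] [ChartedSpace (Model n) M]
  [IsManifold (𝓡 n) ∞ M]
  [RiemannianBundle (fun x : M => TangentSpace (𝓡 n) x)]
  [IsContMDiffRiemannianBundle (𝓡 n) ∞ (Model n) (fun x : M => TangentSpace (𝓡 n) x)]
  {F : Foliation n M p} [MeasurableSpace M]

theorem isAdjointValue_zero (η : LeafForm F 1) :
    IsAdjointValue η (0 : LeafForm F (k + 1)) (0 : LeafForm F k) :=
  ⟨isSmooth_zero, fun α _ => by simp [l2Inner, innerAlt]⟩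

theorem IsAdjointValue.const_smul {η : LeafForm F 1} {β : LeafForm F (k + 1)} {γ : LeafForm F k}
    (h : IsAdjointValue η β γ) (c : ℝ) : IsAdjointValue η (c • β) (c • γ) :=
  ⟨h.1.const_smul c, fun α hα => by rw [l2Inner_smul_right, l2Inner_smul_right, h.2 α hα]⟩

variable [BorelSpace M] [CompactSpace M]

theorem IsAdjointValue.unique {η : LeafForm F 1} {β : LeafForm F (k + 1)} {γ γ' : LeafForm F k}
    (h : IsAdjointValue η β γ) (h' : IsAdjointValue η β γ') : γ = γ' := by
  have hsub := h.1.sub h'.1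
  refine sub_eq_zero.1 ((l2Inner_self_eq_zero hsub).1 ?_)
  rw [l2Inner_sub_right hsub h.1 h'.1, ← h.2 _ hsub, ← h'.2 _ hsub, sub_self]

theorem IsAdjointValue.twistedDelta_eq {η : LeafForm F 1} {β : LeafForm F (k + 1)}
    {γ : LeafForm F k} (h : IsAdjointValue η β γ) : twistedDelta η β = γ := by
  have hex : ∃ γ, IsAdjointValue η β γ := ⟨γ, h⟩
  rw [twistedDelta, dif_pos hex]
  exact hex.choose_spec.unique h

theorem twistedDelta_eq_zero (hk : p < k + 1) (η : LeafForm F 1) (β : LeafForm F (k + 1)) :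
    twistedDelta η β = 0 := by
  have := subsingleton_leafForm (F := F) hk
  rw [Subsingleton.elim β 0]
  exact (isAdjointValue_zero η).twistedDelta_eq

variable [T2Space M] (o : ∀ x : M, Orientation ℝ (F.tangent x) (Fin p))

theorem isAdjointValue_hodgeStar_twistedD_hodgeStar (hF : IsBundleLike F)
    (ho : IsLeafOrientation o) {η : LeafForm F 1} (hη : IsSmooth η) (h : k + 1 + l = p)
    {β : LeafForm F (k + 1)} (hβ : IsSmooth β) :
    IsAdjointValue η β ((-1 : ℝ) ^ (k + 1 + (l + 1) * k) •
      hodgeStar o (by omega : l + 1 + k = p) (twistedD (-η) (hodgeStar o h β))) := by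
  obtain rfl : p = k + l + 1 := by omega
  have hstar := hβ.hodgeStar o ho h
  have hdstar := hη.neg.twistedD hstar
  refine ⟨(hdstar.hodgeStar o ho _).const_smul _, fun α hα => ?_⟩
  have hstokes := l2Inner_leafD_volForm o hF ho (hα.wedge rfl hstar)
  rw [leafD_wedge_eq_twistedD rfl η hα hstar,
    l2Inner_add_left ((hη.twistedD hα).wedge _ hstar) ((hα.wedge _ hdstar).const_smul _)
      (isSmooth_volForm o ho), l2Inner_smul_left, l2Inner_wedge_hodgeStar,
    l2Inner_wedge_volForm] at hstokes
  rw [l2Inner_smul_right, eq_neg_of_add_eq_zero_left hstokes]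
  ring

theorem exists_isAdjointValue (hF : IsBundleLike F) (ho : IsLeafOrientation o)
    {η : LeafForm F 1} (hη : IsSmooth η) {β : LeafForm F (k + 1)} (hβ : IsSmooth β) :
    ∃ γ, IsAdjointValue η β γ := by
  rcases le_or_gt (k + 1) p with hk | hk
  · exact ⟨_, isAdjointValue_hodgeStar_twistedD_hodgeStar o hF ho hη
      (Nat.add_sub_cancel' hk) hβ⟩
  · have := subsingleton_leafForm (F := F) hk
    rw [Subsingleton.elim β 0]
    exact ⟨0, isAdjointValue_zero η⟩

theorem existsUnique_isAdjointValue (hF : IsBundleLike F) (ho : IsLeafOrientation o)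
    {η : LeafForm F 1} (hη : IsSmooth η) {β : LeafForm F (k + 1)} (hβ : IsSmooth β) :
    ∃! γ, IsAdjointValue η β γ :=
  existsUnique_of_exists_of_unique (exists_isAdjointValue o hF ho hη hβ) fun _ _ h₁ h₂ =>
    h₁.unique h₂

end Adjoint

section Intertwining

variable {n p k l : ℕ} {M : Type*} [TopologicalSpace M] [ChartedSpace (Model n) M]
  [IsManifold (𝓡 n) ∞ M]
  [RiemannianBundle (fun x : M => TangentSpace (𝓡 n) x)]
  [IsContMDiffRiemannianBundle (𝓡 n) ∞ (Model n) (fun x : M => TangentSpace (𝓡 n) x)]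
  [MeasurableSpace M] [BorelSpace M] [CompactSpace M] [T2Space M]
  {F : Foliation n M p} (o : ∀ x : M, Orientation ℝ (F.tangent x) (Fin p))

theorem hodgeStar_twistedDelta (hF : IsBundleLike F) (ho : IsLeafOrientation o)
    {η : LeafForm F 1} (hη : IsSmooth η) (h₁ : k + 1 + l = p) (h₂ : k + (l + 1) = p)
    {β : LeafForm F (k + 1)} (hβ : IsSmooth β) :
    hodgeStar o h₂ (twistedDelta η β) =
      (-1 : ℝ) ^ (k + 1) • twistedD (-η) (hodgeStar o h₁ β) := by
  rw [(isAdjointValue_hodgeStar_twistedD_hodgeStar o hF ho hη h₁ hβ).twistedDelta_eq,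
    hodgeStar_smul, hodgeStar_hodgeStar o (by omega : l + 1 + k = p), smul_smul, pow_add,
    mul_assoc, neg_one_pow_mul_self, mul_one]

theorem twistedDelta_hodgeStar (hF : IsBundleLike F) (ho : IsLeafOrientation o)
    {η : LeafForm F 1} (hη : IsSmooth η) (h₁ : k + 1 + l = p) (h₂ : k + (l + 1) = p)
    {β : LeafForm F k} (hβ : IsSmooth β) :
    twistedDelta (-η) (hodgeStar o h₂ β) =
      (-1 : ℝ) ^ (k + 1) • hodgeStar o h₁ (twistedD η β) := by
  rw [(isAdjointValue_hodgeStar_twistedD_hodgeStar o hF ho hη.neg (by omega : l + 1 + k = p)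
    (hβ.hodgeStar o ho h₂)).twistedDelta_eq, hodgeStar_hodgeStar o h₂, neg_neg, twistedD_smul,
    hodgeStar_smul, smul_smul, ← pow_add]
  rw [show l + 1 + (k + 1) * l + k * (l + 1) = k + 1 + 2 * (l + k * l) by ring, pow_add, pow_mul,
    neg_one_sq, one_pow, mul_one]

theorem twistedDelta_smul (hF : IsBundleLike F) (ho : IsLeafOrientation o)
    {η : LeafForm F 1} (hη : IsSmooth η) (c : ℝ) {β : LeafForm F (k + 1)} (hβ : IsSmooth β) :
    twistedDelta η (c • β) = c • twistedDelta η β := by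
  obtain ⟨γ, hγ⟩ := exists_isAdjointValue o hF ho hη hβ
  rw [(hγ.const_smul c).twistedDelta_eq, hγ.twistedDelta_eq]

theorem IsSmooth.twistedDelta (hF : IsBundleLike F) (ho : IsLeafOrientation o)
    {η : LeafForm F 1} (hη : IsSmooth η) {β : LeafForm F (k + 1)} (hβ : IsSmooth β) :
    IsSmooth (twistedDelta η β) := by
  obtain ⟨γ, hγ⟩ := exists_isAdjointValue o hF ho hη hβ
  exact hγ.twistedDelta_eq ▸ hγ.1

theorem hodgeStar_twistedD_twistedDelta (hF : IsBundleLike F) (ho : IsLeafOrientation o)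
    {η : LeafForm F 1} (hη : IsSmooth η) (h : k + 1 + l = p)
    {β : LeafForm F (k + 1)} (hβ : IsSmooth β) :
    hodgeStar o h (twistedD η (twistedDelta η β)) =
      twistedDelta (-η) (twistedD (-η) (hodgeStar o h β)) := by
  have h₂ : k + (l + 1) = p := by omega
  have hsign := twistedDelta_hodgeStar o hF ho hη h h₂ (hη.twistedDelta o hF ho hβ)
  rw [hodgeStar_twistedDelta o hF ho hη h h₂ hβ, twistedDelta_smul o hF ho hη.neg _
    (hη.neg.twistedD (hβ.hodgeStar o ho h))] at hsign
  exact (smul_right_injective _ (pow_ne_zero _ (by norm_num)) hsign).symm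

theorem hodgeStar_twistedDelta_twistedD (hF : IsBundleLike F) (ho : IsLeafOrientation o)
    {η : LeafForm F 1} (hη : IsSmooth η) (h : k + (l + 1) = p)
    {β : LeafForm F k} (hβ : IsSmooth β) :
    hodgeStar o h (twistedDelta η (twistedD η β)) =
      twistedD (-η) (twistedDelta (-η) (hodgeStar o h β)) := by
  have h₁ : k + 1 + l = p := by omega
  rw [hodgeStar_twistedDelta o hF ho hη h₁ h (hη.twistedD hβ),
    twistedDelta_hodgeStar o hF ho hη h₁ h hβ, twistedD_smul]

theorem hodgeStar_twistedLaplacian (hF : IsBundleLike F) (ho : IsLeafOrientation o)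
    {η : LeafForm F 1} (hη : IsSmooth η) (h : k + l = p) {β : LeafForm F k} (hβ : IsSmooth β) :
    hodgeStar o h (twistedLaplacian η β) = twistedLaplacian (-η) (hodgeStar o h β) := by
  have hcoexact (hl : l = 0) : hodgeStar o h (twistedDelta η (twistedD η β)) = 0 := by
    rw [twistedDelta_eq_zero (by omega), hodgeStar_zero]
  have hexact (hk : k = 0) : twistedDelta (-η) (twistedD (-η) (hodgeStar o h β)) = 0 :=
    twistedDelta_eq_zero (by omega) _ _
  rcases k with _ | k <;> rcases l with _ | l
  · simp only [twistedLaplacian, hcoexact rfl, hexact rfl]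
  · simp only [twistedLaplacian, hexact rfl, add_zero,
      hodgeStar_twistedDelta_twistedD o hF ho hη h hβ]
  · simp only [twistedLaplacian, hodgeStar_add, hcoexact rfl, add_zero,
      hodgeStar_twistedD_twistedDelta o hF ho hη h hβ]
  · simp only [twistedLaplacian, hodgeStar_add, hodgeStar_twistedD_twistedDelta o hF ho hη h hβ,
      hodgeStar_twistedDelta_twistedD o hF ho hη h hβ]
    exact add_comm _ _

end Intertwining

end Leafwise

end

theorem mainTheorem7_general {n p : ℕ} {M : Type*} [TopologicalSpace M]
    [ChartedSpace (EuclideanSpace ℝ (Fin n)) M] [IsManifold (𝓡 n) ∞ M]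
    [T2Space M] [CompactSpace M] [MeasurableSpace M] [BorelSpace M]
    [RiemannianBundle (fun x : M => TangentSpace (𝓡 n) x)]
    [IsContMDiffRiemannianBundle (𝓡 n) ∞ (EuclideanSpace ℝ (Fin n))
      (fun x : M => TangentSpace (𝓡 n) x)]
    (F : Leafwise.Foliation n M p) (hF : Leafwise.IsBundleLike F)
    (o : ∀ x : M, Orientation ℝ (F.tangent x) (Fin p)) (ho : Leafwise.IsLeafOrientation o)
    (η : Leafwise.LeafForm F 1) (hη : Leafwise.IsSmooth η) :
    ((∀ (k : ℕ) (β : Leafwise.LeafForm F k), Leafwise.IsSmooth β →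
        Leafwise.IsSmooth (Leafwise.twistedD η β)) ∧
      (∀ (k : ℕ) (β : Leafwise.LeafForm F (k + 1)), Leafwise.IsSmooth β →
        ∃! γ : Leafwise.LeafForm F k, Leafwise.IsAdjointValue η β γ) ∧
      (∀ (k l : ℕ) (h : k + l = p) (β : Leafwise.LeafForm F k), Leafwise.IsSmooth β →
        Leafwise.IsSmooth (Leafwise.hodgeStar o h β) ∧
          ∀ x, ∃! c, Leafwise.IsStarAlt (o x) h (β x) c)) ∧
    (∀ (k l : ℕ) (h : k + l = p) (β : Leafwise.LeafForm F k), Leafwise.IsSmooth β →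
      Leafwise.hodgeStar o h (Leafwise.twistedLaplacian η β) =
        Leafwise.twistedLaplacian (-η) (Leafwise.hodgeStar o h β)) ∧
    (∀ (k l : ℕ) (h : k + l = p) (β : Leafwise.LeafForm F k), Leafwise.IsHarmonic η β →
      Leafwise.IsHarmonic (-η) (Leafwise.hodgeStar o h β)) := by
  have hstar (k l : ℕ) (h : k + l = p) (β : Leafwise.LeafForm F k) (hβ : Leafwise.IsSmooth β) :
      Leafwise.hodgeStar o h (Leafwise.twistedLaplacian η β) =
        Leafwise.twistedLaplacian (-η) (Leafwise.hodgeStar o h β) :=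
    Leafwise.hodgeStar_twistedLaplacian o hF ho hη h hβ
  refine ⟨⟨fun k β hβ => hη.twistedD hβ,
    fun k β hβ => Leafwise.existsUnique_isAdjointValue o hF ho hη hβ,
    fun k l h β hβ => ⟨hβ.hodgeStar o ho h,
      fun x => Leafwise.existsUnique_isStarAlt (o x) h (β x)⟩⟩,
    hstar, fun k l h β hβ => ⟨hβ.1.hodgeStar o ho h, ?_⟩⟩
  rw [← hstar k l h β hβ.1, hβ.2, Leafwise.hodgeStar_zero]

theorem mainTheorem7 {n p : ℕ} {M : Type*} [TopologicalSpace M]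
    [ChartedSpace (EuclideanSpace ℝ (Fin n)) M] [IsManifold (𝓡 n) ∞ M]
    [T2Space M] [CompactSpace M] [MeasurableSpace M] [BorelSpace M]
    [RiemannianBundle (fun x : M => TangentSpace (𝓡 n) x)]
    [IsContMDiffRiemannianBundle (𝓡 n) ∞ (EuclideanSpace ℝ (Fin n))
      (fun x : M => TangentSpace (𝓡 n) x)]
    (F : Leafwise.Foliation n M p) (hF : Leafwise.IsBundleLike F)
    (o : ∀ x : M, Orientation ℝ (F.tangent x) (Fin p)) (ho : Leafwise.IsLeafOrientation o)
    (η : Leafwise.LeafForm F 1) (hη : Leafwise.IsSmooth η) (hdη : Leafwise.leafD η = 0) :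
    -- the operators are well defined on smooth leafwise forms
    ((∀ (k : ℕ) (β : Leafwise.LeafForm F k), Leafwise.IsSmooth β →
        Leafwise.IsSmooth (Leafwise.twistedD η β)) ∧
      (∀ (k : ℕ) (β : Leafwise.LeafForm F (k + 1)), Leafwise.IsSmooth β →
        ∃! γ : Leafwise.LeafForm F k, Leafwise.IsAdjointValue η β γ) ∧
      (∀ (k l : ℕ) (h : k + l = p) (β : Leafwise.LeafForm F k), Leafwise.IsSmooth β →
        Leafwise.IsSmooth (Leafwise.hodgeStar o h β) ∧
          ∀ x, ∃! c, Leafwise.IsStarAlt (o x) h (β x) c)) ∧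
    -- the star operator intertwines the Laplacians
    (∀ (k l : ℕ) (h : k + l = p) (β : Leafwise.LeafForm F k), Leafwise.IsSmooth β →
      Leafwise.hodgeStar o h (Leafwise.twistedLaplacian η β) =
        Leafwise.twistedLaplacian (-η) (Leafwise.hodgeStar o h β)) ∧
    -- and maps harmonic forms to harmonic forms
    (∀ (k l : ℕ) (h : k + l = p) (β : Leafwise.LeafForm F k), Leafwise.IsHarmonic η β →
      Leafwise.IsHarmonic (-η) (Leafwise.hodgeStar o h β)) :=
  mainTheorem7_general F hF o ho η hη
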